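/- **Theorem 2.** Let $\mathbf q_0\in\mathbb C^2$ with $q_0=\Vert\mathbf q_0\Vert>0$, $\delta_\pm,\sigma\in\mathbb R$, $\mathbf q_\pm=\mathbf q_0 e^{i\delta_\pm}$, fix $t\in\mathbb R$, and suppose that $\mathbf q(\cdot,t)-\mathbf q_-\in L^1(-\infty,a)$ and $\mathbf q(\cdot,t)-\mathbf q_+\in L^1(a,\infty)$ for every $a\in\mathbb R$. For $z\in\mathbb C\setminus\{0\}$ put $k=\frac12(z-q_0^2/z)$, $\lambda=\frac12(z+q_0^2/z)$, $\mathbf A=-ik\,\mathrm{diag}(1,-1,-1)+\begin{bmatrix}0&\mathbf q^\dagger\\-\mathbf q&\mathbf 0\end{bmatrix}$, $$\mathbf Y_\pm(z)=\begin{bmatrix}1&0&-iq_0/z\\-\frac iz\mathbf q_\pm&\mathbf q_\pm^\perp/q_0&\mathbf q_\pm/q_0\end{bmatrix},\qquad (v_1,v_2)^\perp=(\bar v_2,-\bar v_1)^T,$$ and $\mathbf\Omega=\mathrm{diag}(\delta_1,\delta_2,\delta_3)$ with $\delta_1=-\lambda x+2(k^2+k\lambda-4k^3\lambda\sigma+2k\lambda\sigma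 q_0^2)t$, $\delta_2=kx+(8k^4\sigma-3\sigma q_0^4-q_0^2)t$, $\delta_3=\lambda x+2(k^2-k\lambda+4k^3\lambda\sigma-2k\lambda\sigma q_0^2)t$. Let $\Sigma^\circ=(\mathbb R\cup\{|z|=q_0\})\setminus\{0,\pm iq_0\}$. For $z\in\Sigma^\circ$ a matrix of Jost eigenfunctions $\psi_\pm(x,t,z)$ is a locally absolutely continuous solution $x\mapsto\psi_\pm\in\mathbb C^{3\times3}$ of $\psi_x=\mathbf A\psi$ on $\mathbb R$ with $\lim_{x\to\pm\infty}\psi_\pm e^{-i\mathbf\Omega}=\mathbf Y_\pm(z)$. Then Jost eigenfunctions exist for every $z\in\Sigma^\circ$. For any choice of them there is an invertible matrix $\mathbf S(z)$, $z\in\Sigma^\circ$, with $\psi_-=\psi_+\mathbf S(z)$ for all $x$. Put $\mathbf H(z)=\mathbf S(z)^{-1}$. The diagonal scattering coefficients extend analytically as follows: - $s_{11}$ to $\mathbb U_1=\{\mathrm{Im}\,z>0,\ |z|>q_0\}$, $s_{22}$ to $\{\mathrm{Im}\,z<0\}$, $s_{33}$ to $\mathbb U_4=\{\mathrm{Im}\,z>0,\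 |z|<q_0\}$; - $h_{11}$ to $\mathbb U_2=\{\mathrm{Im}\,z<0,\ |z|>q_0\}$, $h_{22}$ to $\{\mathrm{Im}\,z>0\}$, $h_{33}$ to $\mathbb U_3=\{\mathrm{Im}\,z<0,\ |z|<q_0\}$. Here a function $s$ on $\Sigma^\circ$ extends analytically to an open set $U$ if there is a function $F$ that is analytic on $U$, continuous on $\overline U\setminus\{0,\pm iq_0\}$, and equal to $s$ on $\overline U\cap\Sigma^\circ$. -/

import Mathlib

open Complex MeasureTheory Filter Topology

/-- Two-component complex vectors with the Euclidean norm. -/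
abbrev Vec2 : Type := EuclideanSpace ℂ (Fin 2)

/-- `3 × 3` complex matrices. -/
abbrev Mat3 : Type := Matrix (Fin 3) (Fin 3) ℂ

noncomputable section

/-- `k = (z - q₀² / z) / 2`. -/
def kOf (q0 : ℝ) (z : ℂ) : ℂ := (z - (q0 : ℂ) ^ 2 / z) / 2

/-- `λ = (z + q₀² / z) / 2`. -/
def lamOf (q0 : ℝ) (z : ℂ) : ℂ := (z + (q0 : ℂ) ^ 2 / z) / 2

/-- `𝐉 = diag(1, -1, -1)`. -/
def matJ : Mat3 := Matrix.diagonal ![1, -1, -1]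

/-- `𝐐 = [[0, 𝐪†], [-𝐪, 0]]`. -/
def matQ (v : Vec2) : Mat3 :=
  !![0, starRingEnd ℂ (v 0), starRingEnd ℂ (v 1);
     -(v 0), 0, 0;
     -(v 1), 0, 0]

/-- The coefficient `𝐀 = -i k 𝐉 + 𝐐` of the spatial part of the Lax pair, at a point where the
potential has the value `v`. -/
def laxA (q0 : ℝ) (z : ℂ) (v : Vec2) : Mat3 := (-(I * kOf q0 z)) • matJ + matQ v

/-- The orthogonal vector `𝐯^⊥ = (v₂, -v₁)†`. -/
def perp (v : Vec2) : Vec2 := !₂[starRingEnd ℂ (v 1), -(starRingEnd ℂ (v 0))]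

/-- The eigenvector matrix `𝐘` belonging to the asymptotic value `v` of the potential. -/
def matY (q0 : ℝ) (v : Vec2) (z : ℂ) : Mat3 :=
  !![1, 0, -(I * q0 / z);
     -(I / z) * v 0, perp v 0 / q0, v 0 / q0;
     -(I / z) * v 1, perp v 1 / q0, v 1 / q0]

/-- The phases `δ₁, δ₂, δ₃`, the diagonal of `𝛀(x, t, z)`. -/
def phase (σ q0 x t : ℝ) (z : ℂ) : Fin 3 → ℂ :=
  let k := kOf q0 z
  let l := lamOf q0 z
  ![-l * x + 2 * (k ^ 2 + k * l - 4 * k ^ 3 * l * σ + 2 * k * l * σ * (q0 : ℂ) ^ 2) * t,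
    k * x + (8 * k ^ 4 * σ - 3 * σ * (q0 : ℂ) ^ 4 - (q0 : ℂ) ^ 2) * t,
    l * x + 2 * (k ^ 2 - k * l + 4 * k ^ 3 * l * σ - 2 * k * l * σ * (q0 : ℂ) ^ 2) * t]

/-- `ψ` solves `ψ_x = 𝐀 ψ` on the real line, for the potential `u` (a profile `𝐪(·, t)`), in the
sense of locally absolutely continuous solutions, since `u` is only locally integrable. -/
def SolvesLaxX (q0 : ℝ) (u : ℝ → Vec2) (z : ℂ) (ψ : ℝ → Mat3) : Prop :=
  Continuous ψ ∧
    ∀ (x y : ℝ) (i j : Fin 3),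
      ψ y i j = ψ x i j + ∫ r in x..y, (laxA q0 z (u r) * ψ r) i j

/-- `ψ` is a matrix of Jost eigenfunctions at time `t`, normalized at the end `l` of the real line
(`atBot` or `atTop`), where the asymptotic value of the potential is `v`: it solves the spatial
part of the Lax pair, and the modified eigenfunction `ν = ψ e^{-i𝛀}` tends to `𝐘`. -/
def IsJost (σ q0 : ℝ) (u : ℝ → Vec2) (t : ℝ) (l : Filter ℝ) (v : Vec2) (z : ℂ)
    (ψ : ℝ → Mat3) : Prop :=
  SolvesLaxX q0 u z ψ ∧
    Tendsto (fun x => ψ x * Matrix.diagonal (fun j => exp (-(I * phase σ q0 x t z j)))) l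
      (𝓝 (matY q0 v z))

/-- `S` is the scattering matrix of the pair `ψ₋, ψ₊`: invertible, with `ψ₋ = ψ₊ S`. -/
def IsScatteringMatrix (ψm ψp : ℝ → Mat3) (S : Mat3) : Prop :=
  IsUnit S ∧ ∀ x, ψm x = ψp x * S

/-- The points `0` and `± i q₀`. -/
def singularPts (q0 : ℝ) : Set ℂ := {0, I * q0, -(I * q0)}

/-- The continuous spectrum `Σ = ℝ ∪ C₀` without the points `0` and `± i q₀`. -/
def contSpec (q0 : ℝ) : Set ℂ := {z | z.im = 0 ∨ ‖z‖ = q0} \ singularPts q0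

/-- `𝕌₁`. -/
def regU1 (q0 : ℝ) : Set ℂ := {z | 0 < z.im ∧ q0 < ‖z‖}

/-- `𝕌₂`. -/
def regU2 (q0 : ℝ) : Set ℂ := {z | z.im < 0 ∧ q0 < ‖z‖}

/-- `𝕌₃`. -/
def regU3 (q0 : ℝ) : Set ℂ := {z | z.im < 0 ∧ ‖z‖ < q0}

/-- `𝕌₄`. -/
def regU4 (q0 : ℝ) : Set ℂ := {z | 0 < z.im ∧ ‖z‖ < q0}

/-- The function `s`, given on the continuous spectrum, extends analytically to the open set `U`:
some `F` is analytic on `U`, continuous up to the boundary of `U` away from the points `0` and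
`± i q₀`, and equal to `s` on the part of the continuous spectrum in the closure of `U`. -/
def ExtendsAnalytically (q0 : ℝ) (U : Set ℂ) (s : ℂ → ℂ) : Prop :=
  ∃ F : ℂ → ℂ, AnalyticOnNhd ℂ F U ∧ ContinuousOn F (closure U \ singularPts q0) ∧
    Set.EqOn F s (closure U ∩ contSpec q0)

end

noncomputable section

/-! Since `S = ψ₊⁻¹ ψ₋`, the entry `S j j` is the `j`-th row of `ψ₊⁻¹` times the `j`-th column of
`ψ₋`, taken at `x = 0`. The column behaves at `-∞` like `e^{μ x}` times an eigenvector, where `μ` is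
the `j`-th of the exponents `-iλ, ik, iλ`. Where `Re μ` is the largest of the three real parts, this
is the most recessive behaviour, and it determines the column.

There the column is a limit of solutions started at `x = -n` from the exact eigenvector. In the
eigenbasis, and after division by `e^{μ x}`, the system is a diagonal matrix with nonpositive real
parts plus an integrable perturbation. Solutions of it do not amplify errors towards the right, so
moving the starting point changes the value at `0` only by a multiple of the tail of the
perturbation (`norm_colApprox_sub_colApprox_le`). The constants are locally bounded in `z`, and the
approximants are holomorphic because the Picard series is entire in `-ik`. The limit is therefore
holomorphic inside the region and continuous up to its boundary
(`colLimit_tendstoLocallyUniformlyOn_recDomain`). At the branch point `-i q₀`, which lies inside the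
region of the middle column, the eigenbasis degenerates; there the maximum principle supplies
convergence (`TendstoLocallyUniformlyOn.of_diff_singleton`).

The row needs no new analysis. The inverse, transposed and reflected in `x`, solves the Lax equation
for the potential `-q̄(-x)`, with the same `z` and the same exponent
(`laxFundInv_isLaxSol_adjoint`). The product of the two limits is the extension (`diagExt`); by
uniqueness of recessive solutions it agrees with `S j j` on the spectrum
(`IsScatteringMatrix.diagExt_eq`).

The entries of `S⁻¹` follow from the symmetry `(x, z, q) ↦ (-x, -z, -q)`, which exchanges the two
ends of the line and turns `S` into `J S⁻¹ J`. For the existence of all Jost columns on the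
spectrum, every exponent there is either recessive, which the limit handles, or dominant, which
`exists_dominant` handles pointwise in `z`. -/

theorem MeasureTheory.LocallyIntegrable.intervalIntegrable_of {E : Type*} [NormedAddCommGroup E]
    {f : ℝ → E} (hf : LocallyIntegrable f) (a b : ℝ) : IntervalIntegrable f volume a b :=
  intervalIntegrable_iff.2
    ((hf.integrableOn_isCompact isCompact_uIcc).mono_set Set.uIoc_subset_uIcc)

theorem MeasureTheory.LocallyIntegrable.norm_comp {E : Type*} [NormedAddCommGroup E]
    {f : ℝ → E} (hf : LocallyIntegrable f) : LocallyIntegrable fun x => ‖f x‖ := fun x =>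
  let ⟨s, hs, hi⟩ := hf x
  ⟨s, hs, hi.norm⟩

/-! ### Calculus of indefinite integrals of locally integrable functions. -/

section Primitive

variable {E F G : Type*} [NormedAddCommGroup E] [NormedSpace ℝ E]
  [NormedAddCommGroup F] [NormedSpace ℝ F]
  [NormedAddCommGroup G] [NormedSpace ℝ G]

/-- `f` is an indefinite integral of the locally integrable function `f'`. -/
structure IsPrimitive (f f' : ℝ → E) : Prop where
  locInt : LocallyIntegrable f'
  sub_eq : ∀ x y, f y - f x = ∫ r in x..y, f' r

theorem MeasureTheory.LocallyIntegrable.isPrimitive {f : ℝ → E}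
    (hf : LocallyIntegrable f) (a : ℝ) : IsPrimitive (fun x => ∫ r in a..x, f r) f :=
  ⟨hf, fun _ _ => intervalIntegral.integral_interval_sub_left
    (hf.intervalIntegrable_of _ _) (hf.intervalIntegrable_of _ _)⟩

namespace IsPrimitive

variable {f f' : ℝ → E} {g g' : ℝ → F}

theorem eq_add (h : IsPrimitive f f') (x y : ℝ) : f y = f x + ∫ r in x..y, f' r := by
  rw [← h.sub_eq]; abel

theorem continuous [CompleteSpace E] (h : IsPrimitive f f') : Continuous f := by
  have : f = fun y => f 0 + ∫ r in (0:ℝ)..y, f' r := funext fun y => h.eq_add 0 y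
  rw [this]
  exact continuous_const.add
    (intervalIntegral.continuous_primitive (fun a b => h.locInt.intervalIntegrable_of a b) 0)

theorem const (c : E) : IsPrimitive (fun _ => c) (fun _ => (0 : E)) :=
  ⟨locallyIntegrable_zero, by simp⟩

theorem add {k k' : ℝ → E} (h : IsPrimitive f f') (hk : IsPrimitive k k') :
    IsPrimitive (fun x => f x + k x) (fun x => f' x + k' x) := by
  refine ⟨h.locInt.add hk.locInt, fun x y => ?_⟩
  rw [intervalIntegral.integral_add (h.locInt.intervalIntegrable_of _ _)
    (hk.locInt.intervalIntegrable_of _ _), ← h.sub_eq, ← hk.sub_eq]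
  abel

theorem clm [CompleteSpace E] [CompleteSpace F] (L : E →L[ℝ] F) (h : IsPrimitive f f') :
    IsPrimitive (fun x => L (f x)) (fun x => L (f' x)) := by
  refine ⟨?_, fun x y => ?_⟩
  · intro x
    obtain ⟨s, hs, hi⟩ := h.locInt x
    exact ⟨s, hs, L.integrable_comp hi⟩
  · rw [L.intervalIntegral_comp_comm (h.locInt.intervalIntegrable_of _ _), ← h.sub_eq, map_sub]

theorem comp_neg (h : IsPrimitive f f') :
    IsPrimitive (fun x => f (-x)) (fun x => -f' (-x)) := by
  refine ⟨?_, fun x y => ?_⟩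
  · rw [locallyIntegrable_iff]
    intro k hk
    have : IntegrableOn f' ((Homeomorph.neg ℝ) '' k) :=
      h.locInt.integrableOn_isCompact (hk.image (Homeomorph.neg ℝ).continuous)
    have h2 := (Measure.measurePreserving_neg (volume : Measure ℝ)).integrableOn_comp_preimage
      (Homeomorph.neg ℝ).measurableEmbedding (f := f') (s := (Homeomorph.neg ℝ) '' k)
    have e : (Neg.neg : ℝ → ℝ) ⁻¹' ((Homeomorph.neg ℝ) '' k) = k :=
      (Homeomorph.neg ℝ).preimage_image k
    rw [e] at h2
    exact (h2.2 this).neg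
  · rw [h.sub_eq, intervalIntegral.integral_neg, intervalIntegral.integral_comp_neg (fun r => f' r),
      intervalIntegral.integral_symm]

theorem of_hasDerivAt [CompleteSpace E] (h : ∀ x, HasDerivAt f (f' x) x) (hc : Continuous f') :
    IsPrimitive f f' :=
  ⟨hc.locallyIntegrable, fun _ _ =>
    (intervalIntegral.integral_eq_sub_of_hasDerivAt (fun z _ => h z)
      (hc.intervalIntegrable _ _)).symm⟩

theorem ae_hasDerivAt [CompleteSpace E] (h : IsPrimitive f f') :
    ∀ᵐ x, HasDerivAt f (f' x) x := by
  filter_upwards [LocallyIntegrable.ae_hasDerivAt_integral h.locInt] with x hx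
  have : f = fun y => f 0 + ∫ r in (0:ℝ)..y, f' r := funext fun y => h.eq_add 0 y
  rw [this]
  simpa using (hx 0).const_add (f 0)

theorem dist_le (h : IsPrimitive f f') {a b : ℝ} :
    dist (f a) (f b) ≤ |∫ r in a..b, ‖f' r‖| := by
  rw [dist_comm, dist_eq_norm, h.sub_eq]
  exact intervalIntegral.norm_integral_le_abs_integral_norm

end IsPrimitive

/-- A bound on single increments passes through the finite sums that define absolute continuity. -/
theorem AbsolutelyContinuousOnInterval.of_dist_le {X Y : Type*} [PseudoMetricSpace X]
    [PseudoMetricSpace Y] {f : ℝ → X} {m : ℝ → Y} {a b C : ℝ}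
    (hm : AbsolutelyContinuousOnInterval m a b)
    (h : ∀ x ∈ Set.uIcc a b, ∀ y ∈ Set.uIcc a b, dist (f x) (f y) ≤ C * dist (m x) (m y)) :
    AbsolutelyContinuousOnInterval f a b := by
  unfold AbsolutelyContinuousOnInterval at hm ⊢
  refine squeeze_zero' ?_ ?_ (by simpa using hm.const_mul C)
  · exact Eventually.of_forall fun _ => Finset.sum_nonneg fun i hi => dist_nonneg
  · rw [eventually_inf_principal]
    filter_upwards with I hI
    rw [Finset.mul_sum]
    exact Finset.sum_le_sum fun i hi => h _ (hI.1 i hi).1 _ (hI.1 i hi).2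

/-- A locally absolutely continuous function whose derivative vanishes almost everywhere is
constant. -/
theorem eq_of_ae_hasDerivAt_zero {f : ℝ → E} {m m' : ℝ → ℝ} (hm : IsPrimitive m m')
    (hle : ∀ a b, ∃ C, ∀ x ∈ Set.uIcc a b, ∀ y ∈ Set.uIcc a b,
      dist (f x) (f y) ≤ C * dist (m x) (m y))
    (h0 : ∀ᵐ x, HasDerivAt f 0 x) (x y : ℝ) : f x = f y := by
  obtain ⟨C, hC⟩ := hle x y
  have hac : AbsolutelyContinuousOnInterval m x y := by
    refine ((hm.locInt.intervalIntegrable_of x y).absolutelyContinuousOnInterval_intervalIntegral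
      (c := x) Set.left_mem_uIcc).of_dist_le (C := 1) fun a _ b _ => ?_
    simp only [one_mul, Real.dist_eq]
    rw [hm.eq_add x a, hm.eq_add x b]
    simp
  obtain ⟨c, hc⟩ := (hac.of_dist_le hC).const_of_ae_hasDerivAt_zero
    (h0.mono fun x hx _ => hx)
  rw [hc x Set.left_mem_uIcc, hc y Set.right_mem_uIcc]

theorem MeasureTheory.LocallyIntegrable.bilin_left (B : E →L[ℝ] F →L[ℝ] G) {f : ℝ → E} {g : ℝ → F}
    (hf : LocallyIntegrable f) (hg : Continuous g) : LocallyIntegrable fun x => B (f x) (g x) := by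
  rw [locallyIntegrable_iff]
  intro k hk
  obtain ⟨C, hC⟩ := hk.exists_bound_of_continuousOn hg.continuousOn
  have hfi := hf.integrableOn_isCompact hk
  refine Integrable.mono' (g := fun x => ‖B‖ * ‖f x‖ * C) ((hfi.norm.const_mul _).mul_const _)
    ?_ ?_
  · exact B.aestronglyMeasurable_comp₂ hfi.aestronglyMeasurable hg.aestronglyMeasurable
  · rw [ae_restrict_iff' hk.measurableSet]
    filter_upwards with x hx
    exact (B.le_opNorm₂ _ _).trans (by gcongr; exact hC x hx)

namespace IsPrimitive

variable {f f' : ℝ → E} {g g' : ℝ → F}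

/-- The product rule for indefinite integrals. -/
theorem bilin [CompleteSpace E] [CompleteSpace F] [CompleteSpace G] (B : E →L[ℝ] F →L[ℝ] G)
    (hf : IsPrimitive f f') (hg : IsPrimitive g g') :
    IsPrimitive (fun x => B (f x) (g x)) (fun x => B (f' x) (g x) + B (f x) (g' x)) := by
  have hl : LocallyIntegrable (fun x => B (f' x) (g x) + B (f x) (g' x)) :=
    (hf.locInt.bilin_left B hg.continuous).add (hg.locInt.bilin_left B.flip hf.continuous)
  have hP := hl.isPrimitive 0
  refine ⟨hl, fun x y => ?_⟩
  -- The product rule holds almost everywhere. To integrate it, the difference must be absolutely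
  -- continuous; it is dominated by the primitive of the sum of the three norms `‖f'‖`, `‖g'‖` and
  -- that of the candidate derivative.
  have key := eq_of_ae_hasDerivAt_zero
    (f := fun x => B (f x) (g x) - ∫ r in (0:ℝ)..x, (B (f' r) (g r) + B (f r) (g' r)))
    (((hf.locInt.norm_comp.add hg.locInt.norm_comp).add hl.norm_comp).isPrimitive 0) ?_ ?_ x y
  · rw [← hP.sub_eq x y, ← sub_eq_zero]
    rw [← sub_eq_zero] at key
    rw [← neg_eq_zero, ← key]
    abel
  · intro a b
    obtain ⟨C₁, h₁⟩ := isCompact_uIcc.exists_bound_of_continuousOn (s := Set.uIcc a b)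
      hf.continuous.continuousOn
    obtain ⟨C₂, h₂⟩ := isCompact_uIcc.exists_bound_of_continuousOn (s := Set.uIcc a b)
      hg.continuous.continuousOn
    have hC₁ : 0 ≤ C₁ := (norm_nonneg _).trans (h₁ a Set.left_mem_uIcc)
    have hC₂ : 0 ≤ C₂ := (norm_nonneg _).trans (h₂ a Set.left_mem_uIcc)
    -- The three summands pay for the increments of `f`, of `g` and of the primitive.
    refine ⟨‖B‖ * C₂ + ‖B‖ * C₁ + 1, fun x hx y hy => ?_⟩
    have hfn := hf.dist_le (a := x) (b := y)
    have hgn := hg.dist_le (a := x) (b := y)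
    have hPn := hP.dist_le (a := x) (b := y)
    have i₁ : ∀ a b, IntervalIntegrable (fun r => ‖f' r‖) volume a b :=
      hf.locInt.norm_comp.intervalIntegrable_of
    have i₂ : ∀ a b, IntervalIntegrable (fun r => ‖g' r‖) volume a b :=
      hg.locInt.norm_comp.intervalIntegrable_of
    have i₃ : ∀ a b, IntervalIntegrable (fun r => ‖B (f' r) (g r) + B (f r) (g' r)‖) volume a b :=
      hl.norm_comp.intervalIntegrable_of
    have hM : dist (∫ r in (0:ℝ)..x, ((fun r => ‖f' r‖) + (fun r => ‖g' r‖) +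
        (fun r => ‖B (f' r) (g r) + B (f r) (g' r)‖)) r) (∫ r in (0:ℝ)..y, ((fun r => ‖f' r‖) +
        (fun r => ‖g' r‖) + (fun r => ‖B (f' r) (g r) + B (f r) (g' r)‖)) r) =
        |∫ r in x..y, ‖f' r‖| + |∫ r in x..y, ‖g' r‖| +
          |∫ r in x..y, ‖B (f' r) (g r) + B (f r) (g' r)‖| := by
      have e : ∀ x y : ℝ, (∫ r in x..y, ((fun r => ‖f' r‖) + (fun r => ‖g' r‖) +
        (fun r => ‖B (f' r) (g r) + B (f r) (g' r)‖)) r) =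
        (∫ r in x..y, ‖f' r‖) + (∫ r in x..y, ‖g' r‖) +
          ∫ r in x..y, ‖B (f' r) (g r) + B (f r) (g' r)‖ := by
        intro x y
        simp only [Pi.add_apply]
        rw [intervalIntegral.integral_add ((i₁ _ _).add (i₂ _ _)) (i₃ _ _),
          intervalIntegral.integral_add (i₁ _ _) (i₂ _ _)]
      rw [dist_comm, Real.dist_eq, intervalIntegral.integral_interval_sub_left, e]
      · rcases le_total x y with h | h
        · rw [abs_of_nonneg, abs_of_nonneg, abs_of_nonneg, abs_of_nonneg] <;>
          (try refine add_nonneg (add_nonneg ?_ ?_) ?_) <;>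
          exact intervalIntegral.integral_nonneg h fun _ _ => norm_nonneg _
        · have hn : ∀ k : ℝ → ℝ, (∀ r, 0 ≤ k r) → ∫ r in x..y, k r ≤ 0 := by
            intro k hk
            rw [intervalIntegral.integral_symm, neg_nonpos]
            exact intervalIntegral.integral_nonneg h fun _ _ => hk _
          have n₁ := hn _ fun r => norm_nonneg (f' r)
          have n₂ := hn _ fun r => norm_nonneg (g' r)
          have n₃ := hn _ fun r => norm_nonneg (B (f' r) (g r) + B (f r) (g' r))
          rw [abs_of_nonpos n₁, abs_of_nonpos n₂, abs_of_nonpos n₃, abs_of_nonpos (by linarith)]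
          ring
      · exact ((i₁ _ _).add (i₂ _ _)).add (i₃ _ _)
      · exact ((i₁ _ _).add (i₂ _ _)).add (i₃ _ _)
    rw [hM]
    have hsplit : dist (B (f x) (g x)) (B (f y) (g y)) ≤
        ‖B‖ * dist (f x) (f y) * C₂ + ‖B‖ * C₁ * dist (g x) (g y) := by
      rw [dist_eq_norm, dist_eq_norm, dist_eq_norm]
      have : B (f x) (g x) - B (f y) (g y) = B (f x - f y) (g x) + B (f y) (g x - g y) := by
        simp
      rw [this]
      refine (norm_add_le _ _).trans (add_le_add ?_ ?_)
      · exact (B.le_opNorm₂ _ _).trans (by gcongr; exact h₂ x hx)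
      · exact (B.le_opNorm₂ _ _).trans (by gcongr; exact h₁ y hy)
    refine (dist_sub_sub_le _ _ _ _).trans ((add_le_add hsplit hPn).trans ?_)
    generalize |∫ r in x..y, ‖f' r‖| = p at *
    generalize |∫ r in x..y, ‖g' r‖| = q at *
    have hp : 0 ≤ p := dist_nonneg.trans hfn
    have hq : 0 ≤ q := dist_nonneg.trans hgn
    have hr := abs_nonneg (∫ r in x..y, ‖B (f' r) (g r) + B (f r) (g' r)‖)
    generalize |∫ r in x..y, ‖B (f' r) (g r) + B (f r) (g' r)‖| = r at *
    have e₁ : ‖B‖ * dist (f x) (f y) * C₂ ≤ ‖B‖ * p * C₂ := by gcongr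
    have e₂ : ‖B‖ * C₁ * dist (g x) (g y) ≤ ‖B‖ * C₁ * q := by gcongr
    have e₃ : 0 ≤ ‖B‖ * C₂ * q + ‖B‖ * C₂ * r + ‖B‖ * C₁ * p + ‖B‖ * C₁ * r := by positivity
    nlinarith
  · filter_upwards [hf.ae_hasDerivAt, hg.ae_hasDerivAt, hP.ae_hasDerivAt] with x h₁ h₂ h₃
    have := (B.hasFDerivAt_of_bilinear h₁.hasFDerivAt h₂.hasFDerivAt).hasDerivAt.fun_sub h₃
    simpa [add_comm] using this

theorem mul {A : Type*} [NormedRing A] [NormedAlgebra ℝ A] [CompleteSpace A] {f f' g g' : ℝ → A}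
    (hf : IsPrimitive f f') (hg : IsPrimitive g g') :
    IsPrimitive (fun x => f x * g x) (fun x => f' x * g x + f x * g' x) :=
  hf.bilin (ContinuousLinearMap.mul ℝ A) hg

theorem eq_of_deriv_zero (hf : IsPrimitive f f') (h : ∀ x, f' x = 0) (x y : ℝ) : f x = f y := by
  have := hf.sub_eq y x
  simp only [h, intervalIntegral.integral_zero, sub_eq_zero] at this
  exact this

end IsPrimitive

end Primitive

open scoped Matrix.Norms.Operator

/-- The topology of the operator norm, syntactically. -/
abbrev matTopology : TopologicalSpace Mat3 := PseudoMetricSpace.toUniformSpace.toTopologicalSpace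

/-- The uniformity of the operator norm, syntactically. -/
abbrev matUniformity : UniformSpace Mat3 := PseudoMetricSpace.toUniformSpace

attribute [local instance 10000] matTopology matUniformity

/-! ### Picard series for a linear system, entire in the spectral parameter. -/

section FundamentalSolution

theorem MeasureTheory.LocallyIntegrable.mul_cont {f g : ℝ → Mat3}
    (hf : LocallyIntegrable f) (hg : Continuous g) : LocallyIntegrable fun x => f x * g x :=
  hf.bilin_left (ContinuousLinearMap.mul ℝ Mat3) hg

theorem MeasureTheory.LocallyIntegrable.cont_mul {f g : ℝ → Mat3}
    (hf : LocallyIntegrable f) (hg : Continuous g) : LocallyIntegrable fun x => g x * f x :=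
  hf.bilin_left (ContinuousLinearMap.mul ℝ Mat3).flip hg

theorem IsPrimitive.pow {m b : ℝ → ℝ} (h : IsPrimitive m b) (n : ℕ) :
    IsPrimitive (fun x => m x ^ (n + 1)) (fun x => (n + 1) * (m x ^ n * b x)) := by
  induction n with
  | zero => simpa using h
  | succ n ih =>
    convert! ih.mul h using 1
    funext x
    push_cast
    ring

/-- The coefficient of `κ ^ j` in the `n`-th Picard iterate for `Φ' = (κ J + Q) Φ`. -/
def picardCoeff (J : Mat3) (Q : ℝ → Mat3) : ℕ → ℕ → ℝ → Mat3
  | 0, 0 => fun _ => 1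
  | 0, _ + 1 => fun _ => 0
  | n + 1, 0 => fun x => ∫ r in (0:ℝ)..x, Q r * picardCoeff J Q n 0 r
  | n + 1, j + 1 => fun x =>
      ∫ r in (0:ℝ)..x, (Q r * picardCoeff J Q n (j + 1) r + J * picardCoeff J Q n j r)

/-- The `n`-th Picard iterate for `Φ' = (κ J + Q) Φ`, a polynomial in `κ`. -/
def picardIter (J : Mat3) (Q : ℝ → Mat3) (n : ℕ) (κ : ℂ) (x : ℝ) : Mat3 :=
  ∑ j ∈ Finset.range (n + 1), κ ^ j • picardCoeff J Q n j x

/-- The solution of `Φ' = (κ J + Q) Φ` with `Φ(0) = 1`. -/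
def fundSol (J : Mat3) (Q : ℝ → Mat3) (κ : ℂ) (x : ℝ) : Mat3 := ∑' n, picardIter J Q n κ x

variable {J : Mat3} {Q : ℝ → Mat3}

theorem picardCoeff_continuous (hQ : LocallyIntegrable Q) (n j : ℕ) :
    Continuous (picardCoeff J Q n j) := by
  induction n generalizing j with
  | zero => cases j <;> exact continuous_const
  | succ n ih =>
    cases j with
    | zero => exact ((hQ.mul_cont (ih 0)).isPrimitive 0).continuous
    | succ j =>
      exact (((hQ.mul_cont (ih (j + 1))).add
        (continuous_const.mul (ih j)).locallyIntegrable).isPrimitive 0).continuous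

theorem picardCoeff_eq_zero (n j : ℕ) (h : n < j) (x : ℝ) : picardCoeff J Q n j x = 0 := by
  induction n generalizing j x with
  | zero => cases j with
    | zero => omega
    | succ j => rfl
  | succ n ih => cases j with
    | zero => omega
    | succ j =>
      simp only [picardCoeff]
      rw [intervalIntegral.integral_congr (g := fun _ => 0)]
      · simp
      · intro r _
        simp [ih (j + 1) (by omega), ih j (by omega)]

theorem picardIter_continuous (hQ : LocallyIntegrable Q) (n : ℕ) (κ : ℂ) :
    Continuous (picardIter J Q n κ) :=
  continuous_finsetSum _ fun j _ => (picardCoeff_continuous hQ n j).const_smul (κ ^ j)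

theorem picardIter_succ (hQ : LocallyIntegrable Q) (n : ℕ) (κ : ℂ) (x : ℝ) :
    picardIter J Q (n + 1) κ x = ∫ r in (0:ℝ)..x, (κ • J + Q r) * picardIter J Q n κ r := by
  have hc := picardCoeff_continuous (J := J) hQ n
  have hi : ∀ j, IntervalIntegrable (fun r => Q r * picardCoeff J Q n j r) volume 0 x :=
    fun j => (hQ.mul_cont (hc j)).intervalIntegrable_of _ _
  have hi' : ∀ j, IntervalIntegrable (fun r => J * picardCoeff J Q n j r) volume 0 x :=
    fun j => (continuous_const.mul (hc j)).intervalIntegrable _ _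
  have e : ∀ r, (κ • J + Q r) * picardIter J Q n κ r =
      ∑ j ∈ Finset.range (n + 2), κ ^ j • (Q r * picardCoeff J Q n j r) +
      ∑ j ∈ Finset.range (n + 1), κ ^ (j + 1) • (J * picardCoeff J Q n j r) := by
    intro r
    -- The added top coefficient is zero; including it lets the sum match the degree `n + 1` of the
    -- next iterate.
    rw [Finset.sum_range_succ _ (n + 1), picardCoeff_eq_zero n (n + 1) (by omega)]
    simp only [picardIter, Finset.mul_sum, add_mul, mul_zero, smul_zero, add_zero,
      Matrix.mul_smul, Matrix.smul_mul, smul_smul, Finset.sum_add_distrib, pow_succ]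
    rw [add_comm]
  simp_rw [e]
  rw [intervalIntegral.integral_add, intervalIntegral.integral_finsetSum,
    intervalIntegral.integral_finsetSum]
  · simp_rw [intervalIntegral.integral_smul]
    rw [picardIter, Finset.sum_range_succ', Finset.sum_range_succ' _ (n + 1)]
    simp only [picardCoeff]
    rw [add_right_comm, ← Finset.sum_add_distrib]
    congr 1
    refine Finset.sum_congr rfl fun j _ => ?_
    rw [intervalIntegral.integral_add (hi _) (hi' _), smul_add]
  · exact fun j _ => (hi' j).smul (κ ^ (j + 1))
  · exact fun j _ => (hi j).smul (κ ^ j)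
  · convert! IntervalIntegrable.sum (Finset.range (n + 2)) fun j _ => (hi j).smul (κ ^ j) using 1
    ext1 r
    simp only [Finset.sum_apply, Pi.smul_apply]
  · convert! IntervalIntegrable.sum (Finset.range (n + 1))
      fun j _ => (hi' j).smul (κ ^ (j + 1)) using 1
    ext1 r
    simp only [Finset.sum_apply, Pi.smul_apply]

/-- Induction with the power rule for the absolutely continuous `m`: integrating `b |m|^n / n!` from
`0` gives `|m|^(n+1) / (n+1)!` in absolute value. As `b ≥ 0`, `m` has the sign of `x`, so the two
half-lines are treated separately. -/
theorem picardIter_norm_le (hQ : LocallyIntegrable Q) {m b : ℝ → ℝ} (hm : IsPrimitive m b)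
    (hm0 : m 0 = 0) {κ : ℂ} (hb : ∀ r, ‖κ • J + Q r‖ ≤ b r) (n : ℕ) (x : ℝ) :
    ‖picardIter J Q n κ x‖ ≤ |m x| ^ n / n.factorial := by
  induction n generalizing x with
  | zero => simp [picardIter, picardCoeff]
  | succ n ih =>
    have hb0 : ∀ r, 0 ≤ b r := fun r => (norm_nonneg _).trans (hb r)
    have hmc := hm.continuous
    rw [picardIter_succ hQ]
    have hint : IntervalIntegrable (fun r => b r * (|m r| ^ n / n.factorial)) volume 0 x :=
      (hm.locInt.intervalIntegrable_of 0 x).mul_continuousOn (by fun_prop)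
    have hint' : IntervalIntegrable (fun r => m r ^ n * b r) volume 0 x :=
      (hm.locInt.intervalIntegrable_of 0 x).continuousOn_mul (by fun_prop)
    refine (intervalIntegral.norm_integral_le_abs_of_norm_le ?_ hint).trans (le_of_eq ?_)
    · refine Eventually.of_forall fun r => (norm_mul_le _ _).trans ?_
      exact mul_le_mul (hb r) (ih r) (norm_nonneg _) (hb0 r)
    · have hpow := (hm.pow n).sub_eq 0 x
      simp only [hm0, ne_eq, Nat.add_eq_zero_iff, one_ne_zero, and_false, not_false_eq_true,
        zero_pow, sub_zero] at hpow
      rw [intervalIntegral.integral_const_mul] at hpow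
      have habs : |∫ r in (0:ℝ)..x, b r * (|m r| ^ n / n.factorial)| =
          |∫ r in (0:ℝ)..x, m r ^ n * b r| / n.factorial := by
        rcases le_total 0 x with h | h
        · rw [← abs_of_nonneg (a := (n.factorial : ℝ)) (by positivity), ← abs_div]
          congr 1
          rw [← intervalIntegral.integral_div]
          refine intervalIntegral.integral_congr fun r hr => ?_
          rw [Set.uIcc_of_le h] at hr
          have : 0 ≤ m r := by
            have := hm.eq_add 0 r
            rw [this, hm0, zero_add]
            exact intervalIntegral.integral_nonneg hr.1 fun _ _ => hb0 _
          simp only [abs_of_nonneg this, Nat.abs_cast]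
          ring
        · have : ∀ r ∈ Set.uIcc 0 x, b r * (|m r| ^ n / n.factorial) =
              ((-1) ^ n / n.factorial) * (m r ^ n * b r) := by
            intro r hr
            rw [Set.uIcc_of_ge h] at hr
            have : m r ≤ 0 := by
              have := hm.eq_add 0 r
              rw [this, hm0, zero_add, intervalIntegral.integral_symm, neg_nonpos]
              exact intervalIntegral.integral_nonneg hr.2 fun _ _ => hb0 _
            rw [abs_of_nonpos this, neg_pow]
            ring
          rw [intervalIntegral.integral_congr this, intervalIntegral.integral_const_mul,
            abs_mul, abs_div, abs_pow, abs_neg, abs_one, one_pow, Nat.abs_cast]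
          ring
      rw [habs, Nat.factorial_succ, ← abs_pow, hpow, abs_mul, Nat.cast_mul,
        abs_of_nonneg (a := (n : ℝ) + 1) (by positivity)]
      push_cast
      field_simp

/-- A primitive of an integrable bound of the coefficient, uniform for `‖κ‖ ≤ ρ`. -/
theorem fundSol_bound (J : Mat3) (hQ : LocallyIntegrable Q) (ρ : ℝ) :
    IsPrimitive (fun x => ∫ r in (0:ℝ)..x, (ρ * ‖J‖ + ‖Q r‖)) (fun r => ρ * ‖J‖ + ‖Q r‖) :=
  (continuous_const.locallyIntegrable.add hQ.norm_comp : LocallyIntegrable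
    ((fun _ => ρ * ‖J‖) + fun r => ‖Q r‖)).isPrimitive 0

theorem coeff_norm_le {κ : ℂ} {ρ : ℝ} (h : ‖κ‖ ≤ ρ) (r : ℝ) :
    ‖κ • J + Q r‖ ≤ ρ * ‖J‖ + ‖Q r‖ :=
  (norm_add_le _ _).trans (by gcongr; exact (norm_smul_le _ _).trans (by gcongr))

/-- The iterates are polynomials in `κ`, and the factorial bound is uniform on a ball about the
given point, so the Weierstrass theorem applies. -/
theorem fundSol_differentiable (hQ : LocallyIntegrable Q) (x : ℝ) :
    Differentiable ℂ fun κ => fundSol J Q κ x := by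
  intro κ
  have hm := fundSol_bound J hQ (‖κ‖ + 1)
  refine (differentiableOn_tsum_of_summable_norm (U := Metric.ball 0 (‖κ‖ + 1))
    (Real.summable_pow_div_factorial
      |∫ r in (0:ℝ)..x, ((‖κ‖ + 1) * ‖J‖ + ‖Q r‖)|) (fun n => ?_) Metric.isOpen_ball
    fun n w hw => ?_).differentiableAt (Metric.isOpen_ball.mem_nhds (by simp))
  · refine Differentiable.differentiableOn ?_
    unfold picardIter
    fun_prop
  · refine picardIter_norm_le hQ hm (by simp) (fun r => coeff_norm_le ?_ r) n x
    simpa using (mem_ball_zero_iff.1 hw).le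

theorem fundSol_hasSum (hQ : LocallyIntegrable Q) (κ : ℂ) (x : ℝ) :
    HasSum (fun n => picardIter J Q n κ x) (fundSol J Q κ x) :=
  (Summable.of_norm_bounded (Real.summable_pow_div_factorial _)
    fun n => picardIter_norm_le hQ (fundSol_bound J hQ ‖κ‖) (by simp)
      (fun r => coeff_norm_le le_rfl r) n x).hasSum

theorem fundSol_continuous (hQ : LocallyIntegrable Q) (κ : ℂ) :
    Continuous (fundSol J Q κ) := by
  rw [continuous_iff_continuousAt]
  intro x
  have hm := fundSol_bound J hQ ‖κ‖
  obtain ⟨C, hC⟩ := isCompact_Icc.exists_bound_of_continuousOn (s := Set.Icc (x - 1) (x + 1))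
      hm.continuous.continuousOn
  refine (continuousOn_tsum (s := Set.Icc (x - 1) (x + 1))
    (fun n => (picardIter_continuous hQ n κ).continuousOn)
    (Real.summable_pow_div_factorial C) fun n y hy => ?_).continuousAt
    (Icc_mem_nhds (by linarith) (by linarith))
  refine (picardIter_norm_le hQ hm (by simp) (fun r => coeff_norm_le le_rfl r) n y).trans ?_
  gcongr
  exact hC y hy

theorem fundSol_eq (hQ : LocallyIntegrable Q) (κ : ℂ) (x : ℝ) :
    fundSol J Q κ x = 1 + ∫ r in (0:ℝ)..x, (κ • J + Q r) * fundSol J Q κ r := by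
  have hm := fundSol_bound J hQ ‖κ‖
  set m := fun x => ∫ r in (0:ℝ)..x, (‖κ‖ * ‖J‖ + ‖Q r‖) with hm_def
  have hA : LocallyIntegrable fun r => κ • J + Q r :=
    (continuous_const.locallyIntegrable : LocallyIntegrable fun _ : ℝ => κ • J).add hQ
  obtain ⟨C, hC⟩ := isCompact_uIcc.exists_bound_of_continuousOn (s := Set.uIcc 0 x)
      hm.continuous.continuousOn
  have hs := fundSol_hasSum (J := J) hQ κ
  have key : HasSum (fun n => ∫ r in (0:ℝ)..x, (κ • J + Q r) * picardIter J Q n κ r)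
      (∫ r in (0:ℝ)..x, (κ • J + Q r) * fundSol J Q κ r) := by
    refine intervalIntegral.hasSum_integral_of_dominated_convergence
      (fun n r => (‖κ‖ * ‖J‖ + ‖Q r‖) * (C ^ n / n.factorial)) (fun n => ?_) (fun n => ?_) ?_ ?_ ?_
    · exact ((hA.mul_cont (picardIter_continuous hQ n κ)).intervalIntegrable_of 0
        x).aestronglyMeasurable_restrict_uIoc
    · refine Eventually.of_forall fun r hr => (norm_mul_le _ _).trans ?_
      gcongr
      · exact coeff_norm_le le_rfl r
      · refine (picardIter_norm_le hQ hm (by simp [hm_def]) (fun r => coeff_norm_le le_rfl r) n r).trans ?_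
        gcongr
        exact hC r (Set.uIoc_subset_uIcc hr)
    · exact Eventually.of_forall fun r _ => (Real.summable_pow_div_factorial C).mul_left _
    · have e : (fun r => ∑' n : ℕ, (‖κ‖ * ‖J‖ + ‖Q r‖) * (C ^ n / n.factorial)) =
          fun r => (‖κ‖ * ‖J‖ + ‖Q r‖) * ∑' n : ℕ, (C ^ n / n.factorial) :=
        funext fun r => tsum_mul_left
      rw [e]
      exact (hm.locInt.intervalIntegrable_of 0 x).mul_const _
    · exact Eventually.of_forall fun r _ => (hs r).mul_left _
  have hsucc : (fun n => ∫ r in (0:ℝ)..x, (κ • J + Q r) * picardIter J Q n κ r) =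
      fun n => picardIter J Q (n + 1) κ x := funext fun n => (picardIter_succ hQ n κ x).symm
  rw [hsucc] at key
  have h1 : picardIter J Q 0 κ x = 1 := by simp [picardIter, picardCoeff]
  rw [← key.tsum_eq, fundSol, (hs x).summable.tsum_eq_zero_add, h1]

theorem fundSol_zero (hQ : LocallyIntegrable Q) (κ : ℂ) : fundSol J Q κ 0 = 1 := by
  rw [fundSol_eq hQ]; simp

theorem fundSol_isPrimitive (hQ : LocallyIntegrable Q) (κ : ℂ) :
    IsPrimitive (fundSol J Q κ) (fun x => (κ • J + Q x) * fundSol J Q κ x) := by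
  have hA : LocallyIntegrable fun r => κ • J + Q r :=
    (continuous_const.locallyIntegrable : LocallyIntegrable fun _ : ℝ => κ • J).add hQ
  have hP := (hA.mul_cont (fundSol_continuous (J := J) hQ κ)).isPrimitive 0
  refine ⟨hP.locInt, fun x y => ?_⟩
  rw [← hP.sub_eq, fundSol_eq hQ κ x, fundSol_eq hQ κ y]
  abel

end FundamentalSolution

/-- Transposition as a continuous linear map. -/
def transposeL : Mat3 →L[ℝ] Mat3 :=
  LinearMap.toContinuousLinearMap (Matrix.transposeLinearEquiv (Fin 3) (Fin 3) ℝ ℂ).toLinearMap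

@[simp] theorem transposeL_apply (A : Mat3) : transposeL A = A.transpose := rfl

theorem MeasureTheory.LocallyIntegrable.clm {E F : Type*} [NormedAddCommGroup E] [NormedSpace ℝ E]
    [NormedAddCommGroup F] [NormedSpace ℝ F] {f : ℝ → E} (hf : LocallyIntegrable f)
    (L : E →L[ℝ] F) : LocallyIntegrable fun x => L (f x) := fun x =>
  let ⟨s, hs, hi⟩ := hf x
  ⟨s, hs, L.integrable_comp hi⟩

/-! ### The inverse fundamental matrix through the adjoint equation. -/

section FundamentalInverse

variable {J : Mat3} {Q : ℝ → Mat3}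

/-- The inverse of `fundSol`. -/
def fundInv (J : Mat3) (Q : ℝ → Mat3) (κ : ℂ) (x : ℝ) : Mat3 :=
  (fundSol (-J.transpose) (fun r => -(Q r).transpose) κ x).transpose

theorem locallyIntegrable_neg_transpose (hQ : LocallyIntegrable Q) :
    LocallyIntegrable fun r => -(Q r).transpose :=
  hQ.clm (-transposeL)

theorem fundInv_differentiable (hQ : LocallyIntegrable Q) (x : ℝ) :
    Differentiable ℂ fun κ => fundInv J Q κ x := by
  have := fundSol_differentiable (J := -J.transpose) (locallyIntegrable_neg_transpose hQ) x
  exact (LinearMap.toContinuousLinearMap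
    (Matrix.transposeLinearEquiv (Fin 3) (Fin 3) ℂ ℂ).toLinearMap).differentiable.comp this

theorem fundInv_isPrimitive (hQ : LocallyIntegrable Q) (κ : ℂ) :
    IsPrimitive (fundInv J Q κ) (fun x => -(fundInv J Q κ x * (κ • J + Q x))) := by
  convert! (fundSol_isPrimitive (J := -J.transpose)
    (locallyIntegrable_neg_transpose hQ) κ).clm transposeL using 2 with x
  simp only [transposeL_apply, Matrix.transpose_mul, Matrix.transpose_add, Matrix.transpose_smul,
    Matrix.transpose_neg, Matrix.transpose_transpose, fundInv]
  rw [smul_neg, ← neg_add, mul_neg]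

theorem fundInv_zero (hQ : LocallyIntegrable Q) (κ : ℂ) : fundInv J Q κ 0 = 1 := by
  rw [fundInv, fundSol_zero (locallyIntegrable_neg_transpose hQ), Matrix.transpose_one]

/-- `Ψ ψ` is constant for solutions `ψ` of `ψ' = A ψ` and `Ψ` of `Ψ' = -Ψ A`. -/
theorem IsPrimitive.adjoint_mul_const {A ψ Ψ : ℝ → Mat3}
    (hψ : IsPrimitive ψ fun x => A x * ψ x) (hΨ : IsPrimitive Ψ fun x => -(Ψ x * A x)) (x y : ℝ) :
    Ψ x * ψ x = Ψ y * ψ y :=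
  (hΨ.mul hψ).eq_of_deriv_zero (fun x => by rw [neg_mul, mul_assoc, neg_add_cancel]) x y

theorem fundInv_mul_fundSol (hQ : LocallyIntegrable Q) (κ : ℂ) (x : ℝ) :
    fundInv J Q κ x * fundSol J Q κ x = 1 := by
  rw [(fundSol_isPrimitive hQ κ).adjoint_mul_const (fundInv_isPrimitive hQ κ) x 0,
    fundSol_zero hQ, fundInv_zero hQ, mul_one]

theorem fundSol_mul_fundInv (hQ : LocallyIntegrable Q) (κ : ℂ) (x : ℝ) :
    fundSol J Q κ x * fundInv J Q κ x = 1 :=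
  mul_eq_one_comm.1 (fundInv_mul_fundSol hQ κ x)

/-- The inverse fundamental matrix times any solution is constant, so a solution is determined by
its value at `0`. -/
theorem IsPrimitive.eq_fundSol_mul (hQ : LocallyIntegrable Q) {κ : ℂ} {ψ : ℝ → Mat3}
    (hψ : IsPrimitive ψ fun x => (κ • J + Q x) * ψ x) (x : ℝ) :
    ψ x = fundSol J Q κ x * ψ 0 := by
  have := hψ.adjoint_mul_const (fundInv_isPrimitive hQ κ) x 0
  rw [fundInv_zero hQ, one_mul] at this
  rw [← this, ← mul_assoc, fundSol_mul_fundInv hQ, one_mul]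

theorem IsPrimitive.mul_const {A ψ : ℝ → Mat3} (hψ : IsPrimitive ψ fun x => A x * ψ x) (c : Mat3) :
    IsPrimitive (fun x => ψ x * c) fun x => A x * (ψ x * c) := by
  convert! hψ.mul (IsPrimitive.const c) using 2
  rw [mul_zero, add_zero, mul_assoc]

end FundamentalInverse

/-! ### Eigenvectors and symmetries of the asymptotic Lax matrix. -/

section LaxAlgebra

/-- The eigenvalues `-iλ, ik, iλ` of the asymptotic coefficient. -/
def expo (q0 : ℝ) (z : ℂ) : Fin 3 → ℂ := ![-(I * lamOf q0 z), I * kOf q0 z, I * lamOf q0 z]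

/-- The inverse of `matY`. -/
def matYInv (q0 : ℝ) (v : Vec2) (z : ℂ) : Mat3 :=
  !![z ^ 2 / (z ^ 2 + q0 ^ 2), I * z * starRingEnd ℂ (v 0) / (z ^ 2 + q0 ^ 2),
      I * z * starRingEnd ℂ (v 1) / (z ^ 2 + q0 ^ 2);
     0, v 1 / q0, -(v 0) / q0;
     I * q0 * z / (z ^ 2 + q0 ^ 2), z ^ 2 * starRingEnd ℂ (v 0) / (q0 * (z ^ 2 + q0 ^ 2)),
      z ^ 2 * starRingEnd ℂ (v 1) / (q0 * (z ^ 2 + q0 ^ 2))]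

theorem sum_mul_conj (v : Vec2) :
    v 0 * starRingEnd ℂ (v 0) + v 1 * starRingEnd ℂ (v 1) = (‖v‖ : ℂ) ^ 2 := by
  have h := EuclideanSpace.norm_sq_eq v
  rw [Fin.sum_univ_two] at h
  rw [mul_conj, mul_conj, normSq_eq_norm_sq, normSq_eq_norm_sq]
  rw [← ofReal_pow, h]
  push_cast
  ring

theorem matYInv_mul_matY {q0 : ℝ} {v : Vec2} {z : ℂ} (hv : ‖v‖ = q0) (hq : q0 ≠ 0) (hz : z ≠ 0)
    (hw : z ^ 2 + (q0 : ℂ) ^ 2 ≠ 0) : matYInv q0 v z * matY q0 v z = 1 := by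
  have h := sum_mul_conj v
  rw [hv] at h
  have hq' : (q0 : ℂ) ≠ 0 := by exact_mod_cast hq
  have hI := I_sq
  ext i j
  fin_cases i <;> fin_cases j <;>
    simp [matYInv, matY, perp, Matrix.mul_apply, Fin.sum_univ_three] <;> field_simp
  · linear_combination h - (v 0 * starRingEnd ℂ (v 0) + v 1 * starRingEnd ℂ (v 1)) * hI
  · ring
  · linear_combination z * I * h
  · ring
  · linear_combination h
  · ring
  · linear_combination -I * z * h
  · ring
  · linear_combination z ^ 2 * h - q0 ^ 4 * hI

theorem laxA_eq (q0 : ℝ) (z : ℂ) (v : Vec2) :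
    laxA q0 z v = !![-(I * kOf q0 z), starRingEnd ℂ (v 0), starRingEnd ℂ (v 1);
      -(v 0), I * kOf q0 z, 0; -(v 1), 0, I * kOf q0 z] := by
  ext i j
  fin_cases i <;> fin_cases j <;> simp [laxA, matJ, matQ, -neg_smul]

/-- The identity needs no condition on `z ^ 2 + q0 ^ 2`: it persists at `± i q₀`, where the outer
two columns become parallel and only invertibility is lost. -/
theorem laxA_mul_matY {q0 : ℝ} {v : Vec2} {z : ℂ} (hv : ‖v‖ = q0) (hq : q0 ≠ 0) (hz : z ≠ 0) :
    laxA q0 z v * matY q0 v z = matY q0 v z * Matrix.diagonal (expo q0 z) := by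
  have h := sum_mul_conj v
  rw [hv] at h
  have hq' : (q0 : ℂ) ≠ 0 := by exact_mod_cast hq
  have hI := I_sq
  rw [laxA_eq]
  ext i j
  fin_cases i <;> fin_cases j <;>
    simp [expo, kOf, lamOf, matY, perp, Matrix.mul_apply, Fin.sum_univ_three,
      Matrix.diagonal] <;> field_simp
  · linear_combination -2 * h
  · ring
  · linear_combination 2 * z ^ 2 * h + 2 * z ^ 2 * q0 ^ 2 * hI
  · linear_combination -2 * z ^ 2 * v 0 * hI
  · ring
  · linear_combination -2 * z ^ 2 * v 1 * hI
  · ring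

theorem matY_mul_matYInv {q0 : ℝ} {v : Vec2} {z : ℂ} (hv : ‖v‖ = q0) (hq : q0 ≠ 0) (hz : z ≠ 0)
    (hw : z ^ 2 + (q0 : ℂ) ^ 2 ≠ 0) : matY q0 v z * matYInv q0 v z = 1 :=
  mul_eq_one_comm.1 (matYInv_mul_matY hv hq hz hw)

theorem matYInv_mul_laxA {q0 : ℝ} {v : Vec2} {z : ℂ} (hv : ‖v‖ = q0) (hq : q0 ≠ 0) (hz : z ≠ 0)
    (hw : z ^ 2 + (q0 : ℂ) ^ 2 ≠ 0) :
    matYInv q0 v z * laxA q0 z v = Matrix.diagonal (expo q0 z) * matYInv q0 v z := by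
  have h := laxA_mul_matY hv hq hz
  calc matYInv q0 v z * laxA q0 z v
      = matYInv q0 v z * (laxA q0 z v * matY q0 v z) * matYInv q0 v z := by
        rw [mul_assoc, mul_assoc, matY_mul_matYInv hv hq hz hw, mul_one]
    _ = _ := by rw [h, ← mul_assoc, matYInv_mul_matY hv hq hz hw, one_mul]

/-- The vector `-v̄`, which carries the transposed spectral problem. -/
def negConj (v : Vec2) : Vec2 := !₂[-starRingEnd ℂ (v 0), -starRingEnd ℂ (v 1)]

theorem norm_negConj (v : Vec2) : ‖negConj v‖ = ‖v‖ := by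
  simp [EuclideanSpace.norm_eq, negConj, Fin.sum_univ_two]

/-- With a reflection in `x`, this turns the adjoint equation into a Lax equation at the same `z`.
-/
theorem laxA_negConj (q0 : ℝ) (z : ℂ) (v : Vec2) :
    laxA q0 z (negConj v) = (laxA q0 z v).transpose := by
  rw [laxA_eq, laxA_eq]
  ext i j
  fin_cases i <;> fin_cases j <;> simp [negConj]

theorem kOf_neg (q0 : ℝ) (z : ℂ) : kOf q0 (-z) = -kOf q0 z := by
  simp only [kOf, div_neg]; ring

theorem lamOf_neg (q0 : ℝ) (z : ℂ) : lamOf q0 (-z) = -lamOf q0 z := by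
  simp only [lamOf, div_neg]; ring

theorem laxA_neg (q0 : ℝ) (z : ℂ) (v : Vec2) : laxA q0 (-z) (-v) = -laxA q0 z v := by
  rw [laxA_eq, laxA_eq, kOf_neg]
  ext i j
  fin_cases i <;> fin_cases j <;> simp

theorem matY_neg (q0 : ℝ) (z : ℂ) (v : Vec2) : matY q0 (-v) (-z) = matY q0 v z * matJ := by
  ext i j
  fin_cases i <;> fin_cases j <;> simp [matY, perp, matJ, Matrix.mul_diagonal, div_neg, neg_div]

theorem phase_neg (σ q0 x t : ℝ) (z : ℂ) : phase σ q0 (-x) t (-z) = phase σ q0 x t z := by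
  simp only [phase, kOf_neg, lamOf_neg, ofReal_neg]
  ring_nf

/-- Time enters only through a factor constant in `x` for each column, so the construction can
ignore it until the normalization. -/
theorem phase_eq (σ q0 x t : ℝ) (z : ℂ) (j : Fin 3) :
    I * phase σ q0 x t z j = expo q0 z j * x + I * phase σ q0 0 t z j := by
  fin_cases j <;> simp [phase, expo] <;> ring

/-- `matQ` as a continuous linear map. -/
def matQL : Vec2 →L[ℝ] Mat3 := LinearMap.toContinuousLinearMap
  { toFun := matQ
    map_add' := fun v w => by
      ext i j
      fin_cases i <;> fin_cases j <;> simp [matQ, add_comm]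
    map_smul' := fun c v => by
      ext i j
      fin_cases i <;> fin_cases j <;> simp [matQ] }

theorem differentiableAt_mat {f : ℂ → Mat3} {z : ℂ}
    (h : ∀ i j, DifferentiableAt ℂ (fun w => f w i j) z) : DifferentiableAt ℂ f z := by
  have e : f = fun w => ∑ i, ∑ j, f w i j • Matrix.single i j (1 : ℂ) := by
    funext w
    conv_lhs => rw [Matrix.matrix_eq_sum_single (f w)]
    simp
  rw [e]
  exact DifferentiableAt.fun_sum fun i _ => DifferentiableAt.fun_sum fun j _ => (h i j).smul_const _

theorem differentiableAt_matY (q0 : ℝ) (v : Vec2) {z : ℂ} (hz : z ≠ 0) :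
    DifferentiableAt ℂ (matY q0 v) z := by
  refine differentiableAt_mat fun i j => ?_
  fin_cases i <;> fin_cases j <;> simp [matY] <;> fun_prop (disch := assumption)

theorem differentiableAt_matYInv {q0 : ℝ} (v : Vec2) (hq : q0 ≠ 0) {z : ℂ}
    (hw : z ^ 2 + (q0 : ℂ) ^ 2 ≠ 0) : DifferentiableAt ℂ (matYInv q0 v) z := by
  have hw' : (q0 : ℂ) * (z ^ 2 + (q0 : ℂ) ^ 2) ≠ 0 := mul_ne_zero (by exact_mod_cast hq) hw
  refine differentiableAt_mat fun i j => ?_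
  fin_cases i <;> fin_cases j <;> simp [matYInv] <;>
    fun_prop (disch := first | assumption | simpa using hw')

theorem differentiableAt_expo (q0 : ℝ) (j : Fin 3) {z : ℂ} (hz : z ≠ 0) :
    DifferentiableAt ℂ (fun w => expo q0 w j) z := by
  fin_cases j <;> simp [expo, lamOf, kOf] <;> fun_prop (disch := assumption)

theorem differentiableAt_kOf (q0 : ℝ) {z : ℂ} (hz : z ≠ 0) :
    DifferentiableAt ℂ (kOf q0) z := by
  unfold kOf
  fun_prop (disch := assumption)

end LaxAlgebra

/-! ### Perturbation of dissipative diagonal systems. -/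

section DiagonalEstimate

/-- The diagonal matrix exponential `exp(s diag d)`. -/
def expDiag (d : Fin 3 → ℂ) (s : ℝ) : Mat3 := Matrix.diagonal fun i => exp (d i * s)

theorem expDiag_zero (d : Fin 3 → ℂ) : expDiag d 0 = 1 := by
  simp [expDiag]

theorem expDiag_mul (d : Fin 3 → ℂ) (s r : ℝ) : expDiag d s * expDiag d r = expDiag d (s + r) := by
  simp only [expDiag, Matrix.diagonal_mul_diagonal, ← Complex.exp_add]
  congr 1
  funext i
  push_cast
  ring_nf

theorem expDiag_commute (d : Fin 3 → ℂ) (s : ℝ) :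
    expDiag d s * Matrix.diagonal d = Matrix.diagonal d * expDiag d s := by
  simp only [expDiag, Matrix.diagonal_mul_diagonal, mul_comm]

theorem norm_expDiag_le {d : Fin 3 → ℂ} {s : ℝ} (h : ∀ i, (d i).re * s ≤ 0) :
    ‖expDiag d s‖ ≤ 1 := by
  rw [expDiag, Matrix.linfty_opNorm_diagonal]
  refine (pi_norm_le_iff_of_nonneg zero_le_one).2 fun i => ?_
  rw [Complex.norm_exp, Real.exp_le_one_iff, re_mul_ofReal]
  exact h i

theorem expDiag_mul_of_kernel {d : Fin 3 → ℂ} {c : Mat3} (hc : Matrix.diagonal d * c = 0) (s : ℝ) :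
    expDiag d s * c = c := by
  ext i j
  have h : d i * c i j = 0 := by
    rw [← Matrix.diagonal_mul, hc, Matrix.zero_apply]
  rw [expDiag, Matrix.diagonal_mul]
  rcases mul_eq_zero.1 h with h | h <;> simp [h]

theorem expDiag_hasDerivAt (d : Fin 3 → ℂ) (s : ℝ) :
    HasDerivAt (expDiag d) (Matrix.diagonal d * expDiag d s) s := by
  have h : HasDerivAt (fun (s : ℝ) i => exp (d i * s)) (fun i => d i * exp (d i * s)) s := by
    rw [hasDerivAt_pi]
    intro i
    have := ((hasDerivAt_id s).ofReal_comp.const_mul (d i)).cexp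
    simpa [mul_comm] using this
  have := (LinearMap.toContinuousLinearMap
    (Matrix.diagonalLinearMap (Fin 3) ℝ ℂ)).hasFDerivAt.comp_hasDerivAt s h
  convert! this using 1
  simp only [expDiag, Matrix.diagonal_mul_diagonal]
  rfl

theorem expDiag_continuous (d : Fin 3 → ℂ) : Continuous (expDiag d) :=
  continuous_iff_continuousAt.2 fun s => (expDiag_hasDerivAt d s).continuousAt

variable {d : Fin 3 → ℂ} {R h : ℝ → Mat3}

/-- Variation of constants, with the bound it gives for a dissipative diagonal part. -/
theorem IsPrimitive.norm_sub_expDiag_le (hd : ∀ i, (d i).re ≤ 0)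
    (hh : IsPrimitive h fun x => (Matrix.diagonal d + R x) * h x) (hR : LocallyIntegrable R)
    {a x : ℝ} (hax : a ≤ x) :
    ‖h x - expDiag d (x - a) * h a‖ ≤ ∫ r in a..x, ‖R r‖ * ‖h r‖ := by
  -- In the derivative of `s ↦ e^{(x - s) D} h(s)` the diagonal part cancels and only the
  -- perturbation remains.
  have hE : IsPrimitive (fun s => expDiag d (x - s))
      fun s => -(Matrix.diagonal d * expDiag d (x - s)) := by
    refine IsPrimitive.of_hasDerivAt (fun s => ?_) ?_
    · have := (expDiag_hasDerivAt d (x - s)).scomp s ((hasDerivAt_id s).const_sub x)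
      exact HasDerivAt.congr_deriv (f := fun s => expDiag d (x - s)) this (by simp)
    · exact (continuous_const.mul
        ((expDiag_continuous d).comp (continuous_const.sub continuous_id))).neg
  have hP : IsPrimitive (fun s => expDiag d (x - s) * h s)
      fun s => expDiag d (x - s) * (R s * h s) := by
    convert! hE.mul hh using 2
    rw [← mul_assoc _ (Matrix.diagonal d + _), mul_add, expDiag_commute]
    simp only [add_mul, neg_mul, mul_assoc]
    abel
  have := hP.sub_eq a x
  simp only [sub_self, expDiag_zero, one_mul] at this
  rw [this]
  refine intervalIntegral.norm_integral_le_of_norm_le hax ?_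
    ((hR.norm_comp.intervalIntegrable_of a x).mul_continuousOn
      hh.continuous.norm.continuousOn)
  refine Eventually.of_forall fun s hs => (norm_mul_le _ _).trans ?_
  refine (mul_le_mul (norm_expDiag_le fun i => ?_) (norm_mul_le _ _) (norm_nonneg _)
    zero_le_one).trans_eq (one_mul _)
  exact mul_nonpos_of_nonpos_of_nonneg (hd i) (by linarith [hs.2])

/-- A solution stays close to an equilibrium of the diagonal part. -/
theorem IsPrimitive.norm_sub_le (hd : ∀ i, (d i).re ≤ 0)
    (hh : IsPrimitive h fun x => (Matrix.diagonal d + R x) * h x) (hR : LocallyIntegrable R)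
    {c : Mat3} (hc : Matrix.diagonal d * c = 0) {a x : ℝ} (hax : a ≤ x)
    (hsmall : ∫ r in a..x, ‖R r‖ ≤ 1 / 2) :
    ‖h x - c‖ ≤ 2 * (‖h a - c‖ + ‖c‖ * ∫ r in a..x, ‖R r‖) := by
  have hcont : Continuous fun y => ‖h y - c‖ := (hh.continuous.sub continuous_const).norm
  -- This replaces Grönwall: at a maximum point the integral term contains the maximum with a factor
  -- at most `1 / 2`, which is absorbed on the left and produces the factor `2` of the bound.
  obtain ⟨y, hy, hmax⟩ := isCompact_Icc.exists_isMaxOn ⟨a, Set.left_mem_Icc.2 hax⟩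
    hcont.continuousOn
  have hRi : ∀ a b, IntervalIntegrable (fun r => ‖R r‖) volume a b :=
    hR.norm_comp.intervalIntegrable_of
  have hmono : ∫ r in a..y, ‖R r‖ ≤ ∫ r in a..x, ‖R r‖ :=
    intervalIntegral.integral_mono_interval le_rfl hy.1 hy.2
      (Eventually.of_forall fun _ => norm_nonneg _) (hRi _ _)
  set M := ‖h y - c‖ with hM
  have h1 : ‖h y - expDiag d (y - a) * h a‖ ≤ (M + ‖c‖) * ∫ r in a..y, ‖R r‖ := by
    refine (hh.norm_sub_expDiag_le hd hR hy.1).trans ?_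
    rw [mul_comm, ← intervalIntegral.integral_mul_const]
    refine intervalIntegral.integral_mono_on hy.1
      ((hRi a y).mul_continuousOn hh.continuous.norm.continuousOn)
      ((hRi a y).mul_const _) fun r hr => ?_
    gcongr
    have hr' : ‖h r - c‖ ≤ M := hmax ⟨hr.1, hr.2.trans hy.2⟩
    calc ‖h r‖ = ‖(h r - c) + c‖ := by rw [sub_add_cancel]
      _ ≤ M + ‖c‖ := (norm_add_le _ _).trans (by gcongr)
  have h2 : ‖expDiag d (y - a) * (h a - c)‖ ≤ ‖h a - c‖ := by
    refine (norm_mul_le _ _).trans (mul_le_of_le_one_left (norm_nonneg _) ?_)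
    exact norm_expDiag_le fun i =>
      mul_nonpos_of_nonpos_of_nonneg (hd i) (by linarith [hy.1])
  have h3 : M ≤ (M + ‖c‖) * (∫ r in a..y, ‖R r‖) + ‖h a - c‖ := by
    have e : h y - c = (h y - expDiag d (y - a) * h a) + expDiag d (y - a) * (h a - c) := by
      rw [mul_sub, expDiag_mul_of_kernel hc]
      abel
    calc M = _ := by rw [hM, e]
      _ ≤ _ := (norm_add_le _ _).trans (add_le_add h1 h2)
  have hx : ‖h x - c‖ ≤ M := hmax (Set.right_mem_Icc.2 hax)
  have h0 : 0 ≤ ∫ r in a..y, ‖R r‖ :=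
    intervalIntegral.integral_nonneg hy.1 fun _ _ => norm_nonneg _
  have hM0 : 0 ≤ M := norm_nonneg _
  have hc0 := norm_nonneg c
  have h4 : (M + ‖c‖) * (∫ r in a..y, ‖R r‖) ≤
      M * (1 / 2) + ‖c‖ * ∫ r in a..x, ‖R r‖ := by
    rw [add_mul]
    gcongr
    exact hmono.trans hsmall
  linarith

end DiagonalEstimate

/-! ### Lax solutions in the eigenbasis and estimates from the tail at `-∞`. -/

section Lax

/-- `ψ` solves the spatial part of the Lax pair, as a matrix-valued indefinite integral. -/
def IsLaxSol (q0 : ℝ) (u : ℝ → Vec2) (z : ℂ) (ψ : ℝ → Mat3) : Prop :=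
  IsPrimitive ψ fun x => laxA q0 z (u x) * ψ x

/-- The fundamental matrix of the Lax equation normalized at `x = 0`. -/
def laxFund (q0 : ℝ) (u : ℝ → Vec2) (z : ℂ) (x : ℝ) : Mat3 :=
  fundSol matJ (fun r => matQ (u r)) (-(I * kOf q0 z)) x

/-- The inverse of `laxFund`. -/
def laxFundInv (q0 : ℝ) (u : ℝ → Vec2) (z : ℂ) (x : ℝ) : Mat3 :=
  fundInv matJ (fun r => matQ (u r)) (-(I * kOf q0 z)) x

variable {q0 : ℝ} {u : ℝ → Vec2} {z : ℂ} {ψ : ℝ → Mat3} {v : Vec2}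

theorem laxFund_isLaxSol (hu : LocallyIntegrable u) (z : ℂ) :
    IsLaxSol q0 u z (laxFund q0 u z) :=
  fundSol_isPrimitive (hu.clm matQL) _

theorem laxFundInv_isPrimitive (hu : LocallyIntegrable u) (z : ℂ) :
    IsPrimitive (laxFundInv q0 u z) fun x => -(laxFundInv q0 u z x * laxA q0 z (u x)) :=
  fundInv_isPrimitive (hu.clm matQL) _

theorem laxFundInv_zero (hu : LocallyIntegrable u) (z : ℂ) : laxFundInv q0 u z 0 = 1 :=
  fundInv_zero (hu.clm matQL) _

theorem laxFundInv_mul_laxFund (hu : LocallyIntegrable u) (z : ℂ) (x : ℝ) :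
    laxFundInv q0 u z x * laxFund q0 u z x = 1 :=
  fundInv_mul_fundSol (hu.clm matQL) _ _

theorem laxFund_mul_laxFundInv (hu : LocallyIntegrable u) (z : ℂ) (x : ℝ) :
    laxFund q0 u z x * laxFundInv q0 u z x = 1 :=
  fundSol_mul_fundInv (hu.clm matQL) _ _

theorem IsLaxSol.eq_laxFund_mul (hu : LocallyIntegrable u) (h : IsLaxSol q0 u z ψ) (x : ℝ) :
    ψ x = laxFund q0 u z x * ψ 0 :=
  IsPrimitive.eq_fundSol_mul (hu.clm matQL) h x

theorem IsLaxSol.mul_const (h : IsLaxSol q0 u z ψ) (c : Mat3) :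
    IsLaxSol q0 u z fun x => ψ x * c :=
  IsPrimitive.mul_const h c

theorem laxFundInv_differentiableAt (hu : LocallyIntegrable u) (x : ℝ) (hz : z ≠ 0) :
    DifferentiableAt ℂ (fun w => laxFundInv q0 u w x) z := by
  have h := (fundInv_differentiable (J := matJ) (hu.clm matQL) x) (-(I * kOf q0 z))
  exact DifferentiableAt.comp (g := fun κ => fundInv matJ (fun r => matQ (u r)) κ x)
    (f := fun w => -(I * kOf q0 w)) z h ((differentiableAt_kOf q0 hz).const_mul I).fun_neg

theorem locallyIntegrable_of_Iio (hB : ∀ a : ℝ, IntegrableOn (fun x => u x - v) (Set.Iio a)) :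
    LocallyIntegrable u := by
  have h : LocallyIntegrable fun x => u x - v := fun x =>
    ⟨Set.Iio (x + 1), Iio_mem_nhds (by linarith), hB _⟩
  have := h.add (continuous_const (y := v)).locallyIntegrable
  convert! this using 1
  funext x
  simp

/-- The modified solution in the eigenbasis of the asymptotic coefficient. -/
def gauged (q0 : ℝ) (v : Vec2) (z : ℂ) (j : Fin 3) (ψ : ℝ → Mat3) (x : ℝ) : Mat3 :=
  exp (-(expo q0 z j * x)) • (matYInv q0 v z * ψ x)

/-- The perturbation in the eigenbasis of the asymptotic coefficient. -/
def pert (q0 : ℝ) (u : ℝ → Vec2) (v : Vec2) (z : ℂ) (x : ℝ) : Mat3 :=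
  matYInv q0 v z * (matQ (u x) - matQ v) * matY q0 v z

theorem locallyIntegrable_matQ_sub (hu : LocallyIntegrable u) (v : Vec2) :
    LocallyIntegrable fun x => matQ (u x) - matQ v :=
  (hu.clm matQL).sub (continuous_const (y := matQ v)).locallyIntegrable

theorem locallyIntegrable_pert (hu : LocallyIntegrable u) : LocallyIntegrable (pert q0 u v z) :=
  ((locallyIntegrable_matQ_sub hu v).cont_mul continuous_const).mul_cont continuous_const

theorem IsPrimitive.exp_smul {f f' : ℝ → Mat3} (h : IsPrimitive f f') (μ : ℂ) :
    IsPrimitive (fun x => exp (-(μ * x)) • f x)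
      (fun x => exp (-(μ * x)) • (f' x - μ • f x)) := by
  have hE : IsPrimitive (fun x : ℝ => exp (-(μ * x))) (fun x : ℝ => -(μ * exp (-(μ * x)))) := by
    refine IsPrimitive.of_hasDerivAt (fun x => ?_) (by fun_prop)
    have := ((hasDerivAt_id x).ofReal_comp.const_mul μ).neg.cexp
    refine HasDerivAt.congr_deriv (f := fun x : ℝ => exp (-(μ * x))) this ?_
    simp [mul_comm]
  convert! hE.bilin (ContinuousLinearMap.lsmul ℝ ℂ) h using 2 with x
  simp only [ContinuousLinearMap.lsmul_apply, neg_smul, smul_sub, mul_smul]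
  rw [smul_comm μ]
  abel

/-- Conjugation by the eigenvector matrix diagonalizes the asymptotic part, and the scalar factor
shifts every exponent by the `j`-th. A column with pure asymptotics becomes a perturbed equilibrium.
-/
theorem IsLaxSol.isPrimitive_gauged (hv : ‖v‖ = q0) (hq : q0 ≠ 0) (hz : z ≠ 0)
    (hw : z ^ 2 + (q0 : ℂ) ^ 2 ≠ 0) (h : IsLaxSol q0 u z ψ) (j : Fin 3) :
    IsPrimitive (gauged q0 v z j ψ) fun x =>
      (Matrix.diagonal (fun i => expo q0 z i - expo q0 z j) + pert q0 u v z x) *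
        gauged q0 v z j ψ x := by
  have h1 : IsPrimitive (fun x => matYInv q0 v z * ψ x)
      (fun x => matYInv q0 v z * (laxA q0 z (u x) * ψ x)) :=
    IsPrimitive.clm (ContinuousLinearMap.mul ℝ Mat3 (matYInv q0 v z)) h
  convert! h1.exp_smul (expo q0 z j) using 2
  rename_i x
  rw [gauged, Matrix.mul_smul]
  congr 1
  have e1 : laxA q0 z (u x) = laxA q0 z v + (matQ (u x) - matQ v) := by
    simp only [laxA]
    abel
  have e2 : (Matrix.diagonal fun i => expo q0 z i - expo q0 z j : Mat3) =
      Matrix.diagonal (expo q0 z) - expo q0 z j • (1 : Mat3) := by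
    rw [← Matrix.diagonal_one, ← Matrix.diagonal_smul, Matrix.diagonal_sub]
    simp
  have e3 : pert q0 u v z x * (matYInv q0 v z * ψ x) =
      matYInv q0 v z * ((matQ (u x) - matQ v) * ψ x) := by
    rw [pert, mul_assoc, ← mul_assoc (matY q0 v z), matY_mul_matYInv hv hq hz hw, one_mul,
      mul_assoc]
  rw [add_mul, e3, e2, sub_mul, e1, add_mul, mul_add, ← mul_assoc (matYInv q0 v z) (laxA q0 z v),
    matYInv_mul_laxA hv hq hz hw, Matrix.smul_mul, one_mul, mul_assoc]
  abel

/-- The tail of the perturbation at `-∞`. -/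
def tailNorm (u : ℝ → Vec2) (v : Vec2) (a : ℝ) : ℝ := ∫ x in Set.Iic a, ‖matQ (u x) - matQ v‖

theorem integrableOn_matQ_sub (hB : ∀ a : ℝ, IntegrableOn (fun x => u x - v) (Set.Iio a)) (a : ℝ) :
    IntegrableOn (fun x => ‖matQ (u x) - matQ v‖) (Set.Iic a) := by
  have h := matQL.integrable_comp (hB a)
  rw [integrableOn_Iic_iff_integrableOn_Iio]
  refine Integrable.norm ?_
  convert! h using 2 with x
  exact (matQL.map_sub _ _).symm

theorem tailNorm_tendsto (hB : ∀ a : ℝ, IntegrableOn (fun x => u x - v) (Set.Iio a)) :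
    Tendsto (tailNorm u v) atBot (𝓝 0) := by
  have h := intervalIntegral_tendsto_integral_Iic 0 (integrableOn_matQ_sub hB 0) tendsto_id
  have e : ∀ a, tailNorm u v a = tailNorm u v 0 - ∫ x in a..0, ‖matQ (u x) - matQ v‖ := by
    intro a
    rw [← intervalIntegral.integral_Iic_sub_Iic (integrableOn_matQ_sub hB a)
      (integrableOn_matQ_sub hB 0)]
    simp [tailNorm]
  have h' := h.const_sub (tailNorm u v 0)
  rw [tailNorm, sub_self] at h'
  rw [funext e]
  exact h'

theorem tailNorm_nonneg (a : ℝ) : 0 ≤ tailNorm u v a :=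
  integral_nonneg fun _ => norm_nonneg _

theorem tailNorm_mono (hB : ∀ a : ℝ, IntegrableOn (fun x => u x - v) (Set.Iio a)) {a b : ℝ}
    (h : a ≤ b) : tailNorm u v a ≤ tailNorm u v b :=
  setIntegral_mono_set (integrableOn_matQ_sub hB b) (Eventually.of_forall fun _ => norm_nonneg _)
    (Set.Iic_subset_Iic.2 h).eventuallyLE

theorem integral_pert_le (hB : ∀ a : ℝ, IntegrableOn (fun x => u x - v) (Set.Iio a)) {C : ℝ}
    (hC : ‖matYInv q0 v z‖ * ‖matY q0 v z‖ ≤ C) {a x : ℝ} (hax : a ≤ x) :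
    ∫ r in a..x, ‖pert q0 u v z r‖ ≤ C * tailNorm u v x := by
  have hu := locallyIntegrable_of_Iio hB
  have hi := (locallyIntegrable_matQ_sub hu v).norm_comp.intervalIntegrable_of a x
  have hC0 : 0 ≤ C := le_trans (by positivity) hC
  calc ∫ r in a..x, ‖pert q0 u v z r‖
      ≤ ∫ r in a..x, C * ‖matQ (u r) - matQ v‖ := by
        refine intervalIntegral.integral_mono_on hax
          ((locallyIntegrable_pert hu).norm_comp.intervalIntegrable_of a x)
          (hi.const_mul C) fun r _ => ?_
        calc ‖pert q0 u v z r‖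
            ≤ ‖matYInv q0 v z‖ * ‖matQ (u r) - matQ v‖ * ‖matY q0 v z‖ :=
              (norm_mul_le _ _).trans (by gcongr; exact norm_mul_le _ _)
          _ = ‖matYInv q0 v z‖ * ‖matY q0 v z‖ * ‖matQ (u r) - matQ v‖ := by ring
          _ ≤ _ := by gcongr
    _ = C * ∫ r in a..x, ‖matQ (u r) - matQ v‖ := intervalIntegral.integral_const_mul _ _
    _ ≤ C * tailNorm u v x := by
        gcongr
        rw [intervalIntegral.integral_of_le hax]
        exact setIntegral_mono_set (integrableOn_matQ_sub hB x)
          (Eventually.of_forall fun _ => norm_nonneg _) Set.Ioc_subset_Iic_self.eventuallyLE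

/-- The `j`-th exponential is the most recessive one at `-∞`, at a point with a complete set of
eigenvectors. -/
structure IsRecessive (q0 : ℝ) (j : Fin 3) (z : ℂ) : Prop where
  ne_zero : z ≠ 0
  sq_ne : z ^ 2 + (q0 : ℂ) ^ 2 ≠ 0
  re_le : ∀ i, (expo q0 z i).re ≤ (expo q0 z j).re

variable {j : Fin 3}

/-- Recessiveness is exactly what makes the shifted diagonal part dissipative in the direction of
increasing `x`. -/
theorem IsLaxSol.norm_gauged_sub_le (hv : ‖v‖ = q0) (hq : q0 ≠ 0)
    (hB : ∀ a : ℝ, IntegrableOn (fun x => u x - v) (Set.Iio a)) (hr : IsRecessive q0 j z)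
    (h : IsLaxSol q0 u z ψ) {C : ℝ} (hC : ‖matYInv q0 v z‖ * ‖matY q0 v z‖ ≤ C) {c : Mat3}
    (hc : Matrix.diagonal (fun i => expo q0 z i - expo q0 z j) * c = 0) {a x : ℝ} (hax : a ≤ x)
    (hx : C * tailNorm u v x ≤ 1 / 2) :
    ‖gauged q0 v z j ψ x - c‖ ≤
      2 * (‖gauged q0 v z j ψ a - c‖ + ‖c‖ * (C * tailNorm u v x)) := by
  have hle := integral_pert_le hB hC hax
  refine (IsPrimitive.norm_sub_le (fun i => ?_) (h.isPrimitive_gauged hv hq hr.ne_zero hr.sq_ne j)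
    (locallyIntegrable_pert (locallyIntegrable_of_Iio hB)) hc hax (hle.trans hx)).trans ?_
  · simpa using hr.re_le i
  · gcongr

/-- The value at `0` of the solution that equals `e^{μ_j x} y` at `x = a`. -/
def colApprox (q0 : ℝ) (u : ℝ → Vec2) (j : Fin 3) (y : ℂ → Mat3) (a : ℝ) (z : ℂ) : Mat3 :=
  laxFundInv q0 u z a * (exp (expo q0 z j * a) • y z)

theorem gauged_sub (φ : ℝ → Mat3) (x : ℝ) :
    gauged q0 v z j (fun x => ψ x - φ x) x = gauged q0 v z j ψ x - gauged q0 v z j φ x := by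
  simp only [gauged, mul_sub, smul_sub]

/-- Estimates are obtained at a fixed `x`; undoing the gauge and flowing back to `0` costs a factor
that does not depend on the solution. -/
theorem norm_le_gauged (hv : ‖v‖ = q0) (hq : q0 ≠ 0) (hu : LocallyIntegrable u)
    (hr : IsRecessive q0 j z) (g : Mat3) (x : ℝ) :
    ‖g‖ ≤ ‖laxFundInv q0 u z x‖ * ‖exp (expo q0 z j * x)‖ * ‖matY q0 v z‖ *
      ‖gauged q0 v z j (fun x => laxFund q0 u z x * g) x‖ := by
  have e : g = laxFundInv q0 u z x * (exp (expo q0 z j * x) • (matY q0 v z *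
      gauged q0 v z j (fun x => laxFund q0 u z x * g) x)) := by
    rw [gauged, Matrix.mul_smul (matY q0 v z), smul_smul, ← Complex.exp_add, add_neg_cancel, Complex.exp_zero,
      one_smul, ← mul_assoc (matY q0 v z), matY_mul_matYInv hv hq hr.ne_zero hr.sq_ne, one_mul,
      ← mul_assoc, laxFundInv_mul_laxFund hu, one_mul]
  conv_lhs => rw [e]
  refine (norm_mul_le _ _).trans ?_
  rw [norm_smul, mul_assoc, mul_assoc]
  gcongr
  exact norm_mul_le _ _

theorem gauged_colApprox (hu : LocallyIntegrable u) (y : ℂ → Mat3) (a : ℝ) :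
    gauged q0 v z j (fun x => laxFund q0 u z x * colApprox q0 u j y a z) a =
      matYInv q0 v z * y z := by
  simp only [gauged, colApprox]
  rw [← mul_assoc (laxFund q0 u z a), laxFund_mul_laxFundInv hu, one_mul, Matrix.mul_smul,
    smul_smul, ← Complex.exp_add, neg_add_cancel, Complex.exp_zero, one_smul]

/-- In the eigenbasis an eigenvector for the `j`-th exponent is an equilibrium of the shifted
diagonal part. -/
theorem diagonal_mul_matYInv_mul (hv : ‖v‖ = q0) (hq : q0 ≠ 0) (hz : z ≠ 0)
    (hw : z ^ 2 + (q0 : ℂ) ^ 2 ≠ 0) {y : Mat3} (hy : laxA q0 z v * y = expo q0 z j • y) :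
    Matrix.diagonal (fun i => expo q0 z i - expo q0 z j) * (matYInv q0 v z * y) = 0 := by
  have e2 : (Matrix.diagonal fun i => expo q0 z i - expo q0 z j : Mat3) =
      Matrix.diagonal (expo q0 z) - expo q0 z j • (1 : Mat3) := by
    rw [← Matrix.diagonal_one, ← Matrix.diagonal_smul, Matrix.diagonal_sub]
    simp
  rw [e2, sub_mul, ← mul_assoc, ← matYInv_mul_laxA hv hq hz hw, mul_assoc, hy,
    Matrix.smul_mul, one_mul, Matrix.mul_smul, sub_self]

/-- The difference of two solutions is a solution, so its deviation from the equilibrium `0` at `a`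
controls it at `x₀`, and then at `0`. The factor in front does not depend on `a`. -/
theorem norm_sub_colApprox_le
    (hv : ‖v‖ = q0) (hq : q0 ≠ 0)
    (hB : ∀ a : ℝ, IntegrableOn (fun x => u x - v) (Set.Iio a)) (hr : IsRecessive q0 j z)
    {C : ℝ} (hC : ‖matYInv q0 v z‖ * ‖matY q0 v z‖ ≤ C) {y : ℂ → Mat3}
    {x₀ a : ℝ} (ha : a ≤ x₀) (hx : C * tailNorm u v x₀ ≤ 1 / 2)
    (g : Mat3) :
    ‖g - colApprox q0 u j y a z‖ ≤
      ‖laxFundInv q0 u z x₀‖ * ‖exp (expo q0 z j * x₀)‖ * ‖matY q0 v z‖ *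
      (2 * ‖gauged q0 v z j (fun x => laxFund q0 u z x * g) a - matYInv q0 v z * y z‖) := by
  have hu := locallyIntegrable_of_Iio hB
  refine (norm_le_gauged hv hq hu hr _ x₀).trans ?_
  gcongr
  have := ((laxFund_isLaxSol (q0 := q0) hu z).mul_const
    (g - colApprox q0 u j y a z)).norm_gauged_sub_le hv hq hB hr hC
    (c := 0) (by simp) ha hx
  simp only [sub_zero, norm_zero, zero_mul, add_zero] at this
  refine this.trans_eq ?_
  simp only [mul_sub]
  rw [gauged_sub, gauged_colApprox hu]

theorem norm_gauged_colApprox_le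
    (hv : ‖v‖ = q0) (hq : q0 ≠ 0)
    (hB : ∀ a : ℝ, IntegrableOn (fun x => u x - v) (Set.Iio a)) (hr : IsRecessive q0 j z)
    {y : ℂ → Mat3} (hy : laxA q0 z v * y z = expo q0 z j • y z)
    {C : ℝ} (hC : ‖matYInv q0 v z‖ * ‖matY q0 v z‖ ≤ C)
    {x a : ℝ} (ha : a ≤ x) (hx : C * tailNorm u v x ≤ 1 / 2) :
    ‖gauged q0 v z j (fun x => laxFund q0 u z x * colApprox q0 u j y a z) x -
      matYInv q0 v z * y z‖ ≤ 2 * (‖matYInv q0 v z * y z‖ * (C * tailNorm u v x)) := by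
  have hu := locallyIntegrable_of_Iio hB
  have := ((laxFund_isLaxSol (q0 := q0) hu z).mul_const
    (colApprox q0 u j y a z)).norm_gauged_sub_le hv hq hB hr hC
    (diagonal_mul_matYInv_mul hv hq hr.ne_zero hr.sq_ne hy) ha hx
  rwa [gauged_colApprox hu, sub_self, norm_zero, zero_add] at this

/-- The solution started at `a'` is off the equilibrium at `a` only by the effect of the tail before
`a`, and this discrepancy is carried stably from `a` to `x₀`. Each of the two stages contributes a
factor `2`. -/
theorem norm_colApprox_sub_colApprox_le
    (hv : ‖v‖ = q0) (hq : q0 ≠ 0)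
    (hB : ∀ a : ℝ, IntegrableOn (fun x => u x - v) (Set.Iio a)) (hr : IsRecessive q0 j z)
    {y : ℂ → Mat3} (hy : laxA q0 z v * y z = expo q0 z j • y z)
    {C : ℝ} (hC : ‖matYInv q0 v z‖ * ‖matY q0 v z‖ ≤ C)
    {x₀ a a' : ℝ} (ha : a ≤ x₀) (ha' : a' ≤ a)
    (hx : C * tailNorm u v x₀ ≤ 1 / 2) :
    ‖colApprox q0 u j y a' z - colApprox q0 u j y a z‖ ≤
      ‖laxFundInv q0 u z x₀‖ * ‖exp (expo q0 z j * x₀)‖ * ‖matY q0 v z‖ *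
      (2 * (2 * (‖matYInv q0 v z * y z‖ * (C * tailNorm u v a)))) := by
  refine (norm_sub_colApprox_le hv hq hB hr hC ha hx _).trans ?_
  have hC0 : 0 ≤ C := le_trans (by positivity) hC
  gcongr
  exact norm_gauged_colApprox_le hv hq hB hr hy hC ha'
    ((mul_le_mul_of_nonneg_left (tailNorm_mono hB ha) hC0).trans hx)

end Lax

/-! ### The recessive column: convergence, asymptotics and uniqueness. -/

section ColumnLimit

variable {q0 : ℝ} {u : ℝ → Vec2} {z : ℂ} {ψ : ℝ → Mat3} {v : Vec2} {j : Fin 3} {y : ℂ → Mat3}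

/-- The value at `0` of the solution asymptotic to `e^{μ_j x} y` at `-∞`. -/
def colLimit (q0 : ℝ) (u : ℝ → Vec2) (j : Fin 3) (y : ℂ → Mat3) (z : ℂ) : Mat3 :=
  limUnder atTop fun n : ℕ => colApprox q0 u j y (-n) z

theorem tailNorm_neg_nat_tendsto (hB : ∀ a : ℝ, IntegrableOn (fun x => u x - v) (Set.Iio a)) :
    Tendsto (fun n : ℕ => tailNorm u v (-n)) atTop (𝓝 0) :=
  (tailNorm_tendsto hB).comp (tendsto_neg_atTop_atBot.comp tendsto_natCast_atTop_atTop)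

theorem exists_tailNorm_le (hB : ∀ a : ℝ, IntegrableOn (fun x => u x - v) (Set.Iio a)) (C : ℝ) :
    ∃ x₀, C * tailNorm u v x₀ ≤ 1 / 2 := by
  have h := (tailNorm_tendsto hB).const_mul C
  rw [mul_zero] at h
  exact (h.eventually_le_const (by norm_num : (0 : ℝ) < 1 / 2)).exists

theorem eventually_neg_nat_le (x₀ : ℝ) : ∀ᶠ n : ℕ in atTop, -(n : ℝ) ≤ x₀ :=
  (tendsto_neg_atTop_atBot.comp tendsto_natCast_atTop_atTop).eventually (eventually_le_atBot x₀)

theorem colApprox_tendsto (hv : ‖v‖ = q0) (hq : q0 ≠ 0)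
    (hB : ∀ a : ℝ, IntegrableOn (fun x => u x - v) (Set.Iio a)) (hr : IsRecessive q0 j z)
    (hy : laxA q0 z v * y z = expo q0 z j • y z) :
    Tendsto (fun n : ℕ => colApprox q0 u j y (-n) z) atTop (𝓝 (colLimit q0 u j y z)) := by
  refine CauchySeq.tendsto_limUnder ?_
  obtain ⟨x₀, hx₀⟩ := exists_tailNorm_le hB (‖matYInv q0 v z‖ * ‖matY q0 v z‖)
  rw [Metric.cauchySeq_iff']
  intro ε hε
  have h := (((tailNorm_neg_nat_tendsto hB).const_mul
    (‖matYInv q0 v z‖ * ‖matY q0 v z‖)).const_mul ‖matYInv q0 v z * y z‖ |>.const_mul 2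
    |>.const_mul 2).const_mul
    (‖laxFundInv q0 u z x₀‖ * ‖exp (expo q0 z j * x₀)‖ * ‖matY q0 v z‖)
  simp only [mul_zero] at h
  obtain ⟨N, hN, hN'⟩ := ((eventually_neg_nat_le x₀).and (h.eventually_lt_const hε)).exists
  refine ⟨N, fun n hn => ?_⟩
  rw [dist_eq_norm]
  exact (norm_colApprox_sub_colApprox_le hv hq hB hr hy le_rfl hN
    (neg_le_neg (by exact_mod_cast hn)) hx₀).trans_lt hN'

theorem norm_colLimit_sub_le (hv : ‖v‖ = q0) (hq : q0 ≠ 0)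
    (hB : ∀ a : ℝ, IntegrableOn (fun x => u x - v) (Set.Iio a)) (hr : IsRecessive q0 j z)
    (hy : laxA q0 z v * y z = expo q0 z j • y z) {C : ℝ}
    (hC : ‖matYInv q0 v z‖ * ‖matY q0 v z‖ ≤ C) {x₀ a : ℝ} (ha : a ≤ x₀)
    (hx : C * tailNorm u v x₀ ≤ 1 / 2) :
    ‖colLimit q0 u j y z - colApprox q0 u j y a z‖ ≤
      ‖laxFundInv q0 u z x₀‖ * ‖exp (expo q0 z j * x₀)‖ * ‖matY q0 v z‖ *
      (2 * (2 * (‖matYInv q0 v z * y z‖ * (C * tailNorm u v a)))) := by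
  refine le_of_tendsto ((colApprox_tendsto hv hq hB hr hy).sub_const _).norm ?_
  filter_upwards [eventually_neg_nat_le a] with n hn
  exact norm_colApprox_sub_colApprox_le hv hq hB hr hy hC ha hn hx

theorem colLimit_tendstoLocallyUniformlyOn {D : Set ℂ} (hv : ‖v‖ = q0) (hq : q0 ≠ 0)
    (hB : ∀ a : ℝ, IntegrableOn (fun x => u x - v) (Set.Iio a))
    (hr : ∀ z ∈ D, IsRecessive q0 j z) (hyc : ContinuousOn y D)
    (hy : ∀ z ∈ D, laxA q0 z v * y z = expo q0 z j • y z) :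
    TendstoLocallyUniformlyOn (fun (n : ℕ) z => colApprox q0 u j y (-n) z)
      (colLimit q0 u j y) atTop D := by
  rw [Metric.tendstoLocallyUniformlyOn_iff]
  intro ε hε z hz
  have hu := locallyIntegrable_of_Iio hB
  have hrz := hr z hz
  have cY : ContinuousWithinAt (matY q0 v) D z :=
    (differentiableAt_matY q0 v hrz.ne_zero).continuousAt.continuousWithinAt
  have cYi : ContinuousWithinAt (matYInv q0 v) D z :=
    (differentiableAt_matYInv v hq hrz.sq_ne).continuousAt.continuousWithinAt
  have cC := cYi.norm.mul cY.norm
  -- Adding `1` here and in `K` makes the inequalities strict at `z`, so they persist at nearby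
  -- points of `D` and one `x₀` serves a whole neighbourhood.
  set C := ‖matYInv q0 v z‖ * ‖matY q0 v z‖ + 1 with hC
  obtain ⟨x₀, hx₀⟩ := exists_tailNorm_le hB C
  have cΨ : ContinuousWithinAt (fun w => laxFundInv q0 u w x₀) D z :=
    (laxFundInv_differentiableAt hu x₀ hrz.ne_zero).continuousAt.continuousWithinAt
  have cE : ContinuousWithinAt (fun w => exp (expo q0 w j * x₀)) D z :=
    ((differentiableAt_expo q0 j hrz.ne_zero).continuousAt.mul
      continuousAt_const).cexp.continuousWithinAt
  have cK := ((cΨ.norm.mul cE.norm).mul cY.norm).mul (cYi.mul (hyc z hz)).norm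
  set K := ‖laxFundInv q0 u z x₀‖ * ‖exp (expo q0 z j * x₀)‖ * ‖matY q0 v z‖ *
    ‖matYInv q0 v z * y z‖ + 1 with hK
  have h := (tailNorm_neg_nat_tendsto hB).const_mul (4 * (K * C))
  rw [mul_zero] at h
  refine ⟨_, inter_mem (inter_mem (cC.eventually_lt_const (lt_add_one _))
    (cK.eventually_lt_const (lt_add_one _))) self_mem_nhdsWithin, ?_⟩
  filter_upwards [eventually_neg_nat_le x₀, h.eventually_lt_const hε] with n hn hn' w hw
  obtain ⟨⟨hw1, hw2⟩, hw3⟩ := hw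
  replace hw1 : ‖matYInv q0 v w‖ * ‖matY q0 v w‖ < C := hw1
  replace hw2 : ‖laxFundInv q0 u w x₀‖ * ‖exp (expo q0 w j * x₀)‖ * ‖matY q0 v w‖ *
    ‖matYInv q0 v w * y w‖ < K := hw2
  have hC0 : 0 ≤ C := le_trans (by positivity) hw1.le
  have hT0 := tailNorm_nonneg (u := u) (v := v) (-n)
  rw [dist_eq_norm]
  calc _ ≤ _ := norm_colLimit_sub_le hv hq hB (hr w hw3) (hy w hw3) hw1.le hn hx₀
    _ = 4 * (‖laxFundInv q0 u w x₀‖ * ‖exp (expo q0 w j * x₀)‖ * ‖matY q0 v w‖ *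
      ‖matYInv q0 v w * y w‖ * C) * tailNorm u v (-n) := by ring
    _ ≤ 4 * (K * C) * tailNorm u v (-n) := by gcongr
    _ < ε := hn'

theorem matY_mul_gauged (hv : ‖v‖ = q0) (hq : q0 ≠ 0) (hz : z ≠ 0)
    (hw : z ^ 2 + (q0 : ℂ) ^ 2 ≠ 0) (x : ℝ) :
    matY q0 v z * gauged q0 v z j ψ x = exp (-(expo q0 z j * x)) • ψ x := by
  rw [gauged, Matrix.mul_smul, ← mul_assoc, matY_mul_matYInv hv hq hz hw, one_mul]

theorem colLimit_asymptotics (hv : ‖v‖ = q0) (hq : q0 ≠ 0)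
    (hB : ∀ a : ℝ, IntegrableOn (fun x => u x - v) (Set.Iio a)) (hr : IsRecessive q0 j z)
    (hy : laxA q0 z v * y z = expo q0 z j • y z) :
    Tendsto (fun x : ℝ => exp (-(expo q0 z j * x)) • (laxFund q0 u z x * colLimit q0 u j y z))
      atBot (𝓝 (y z)) := by
  set C := ‖matYInv q0 v z‖ * ‖matY q0 v z‖ with hC
  have hT := (tailNorm_tendsto hB).const_mul C
  have hlim : Tendsto (gauged q0 v z j fun x => laxFund q0 u z x * colLimit q0 u j y z) atBot
      (𝓝 (matYInv q0 v z * y z)) := by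
    rw [tendsto_iff_norm_sub_tendsto_zero]
    have hb := (hT.const_mul ‖matYInv q0 v z * y z‖).const_mul 2
    rw [mul_zero] at hT
    simp only [mul_zero] at hb
    refine squeeze_zero' (Eventually.of_forall fun _ => norm_nonneg _) ?_ hb
    filter_upwards [hT.eventually_le_const (by norm_num : (0 : ℝ) < 1 / 2)] with x hx
    have hc : Continuous fun g : Mat3 =>
        gauged q0 v z j (fun x => laxFund q0 u z x * g) x := by
      unfold gauged
      fun_prop
    refine le_of_tendsto (((hc.tendsto _).comp
      (colApprox_tendsto hv hq hB hr hy)).sub_const _).norm ?_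
    filter_upwards [eventually_neg_nat_le x] with n hn
    exact norm_gauged_colApprox_le hv hq hB hr hy le_rfl hn hx
  have := hlim.const_mul (matY q0 v z)
  rw [← mul_assoc, matY_mul_matYInv hv hq hr.ne_zero hr.sq_ne, one_mul] at this
  exact this.congr fun x => matY_mul_gauged hv hq hr.ne_zero hr.sq_ne x

/-- A recessive normalization determines the solution: its difference from the approximant started
at `-n` is small in the gauge at `-n` and cannot grow by more than a fixed factor up to `x₀`. -/
theorem IsLaxSol.apply_zero_eq_colLimit (hv : ‖v‖ = q0) (hq : q0 ≠ 0)
    (hB : ∀ a : ℝ, IntegrableOn (fun x => u x - v) (Set.Iio a)) (hr : IsRecessive q0 j z)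
    (hy : laxA q0 z v * y z = expo q0 z j • y z) (hψ : IsLaxSol q0 u z ψ)
    (hlim : Tendsto (fun x : ℝ => exp (-(expo q0 z j * x)) • ψ x) atBot (𝓝 (y z))) :
    ψ 0 = colLimit q0 u j y z := by
  have hu := locallyIntegrable_of_Iio hB
  refine tendsto_nhds_unique ?_ (colApprox_tendsto hv hq hB hr hy)
  rw [tendsto_iff_norm_sub_tendsto_zero]
  obtain ⟨x₀, hx₀⟩ := exists_tailNorm_le hB (‖matYInv q0 v z‖ * ‖matY q0 v z‖)
  have h1 : Tendsto (fun x => ‖gauged q0 v z j ψ x - matYInv q0 v z * y z‖) atBot (𝓝 0) := by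
    rw [← tendsto_iff_norm_sub_tendsto_zero]
    refine (hlim.const_mul (matYInv q0 v z)).congr fun x => ?_
    rw [gauged, Matrix.mul_smul]
  have hn : Tendsto (fun n : ℕ => -(n : ℝ)) atTop atBot :=
    tendsto_neg_atTop_atBot.comp tendsto_natCast_atTop_atTop
  have h2 := ((h1.comp hn).const_mul 2).const_mul
    (‖laxFundInv q0 u z x₀‖ * ‖exp (expo q0 z j * x₀)‖ * ‖matY q0 v z‖)
  simp only [mul_zero] at h2
  refine squeeze_zero' (Eventually.of_forall fun _ => norm_nonneg _) ?_ h2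
  filter_upwards [eventually_neg_nat_le x₀] with n hn
  have e : ψ = fun x => laxFund q0 u z x * ψ 0 := funext fun x => hψ.eq_laxFund_mul hu x
  have h3 := norm_sub_colApprox_le hv hq hB hr le_rfl hn hx₀ (y := y) (ψ 0)
  rw [← e] at h3
  rw [norm_sub_rev]
  exact h3

end ColumnLimit

/-! ### Existence of solutions with dominant asymptotics. -/

section Dominant

/-- The spectral projection of `diag r` onto its kernel. -/
def kerProj (r : Fin 3 → ℝ) : Mat3 := Matrix.diagonal fun i => if r i = 0 then 1 else 0

theorem kerProj_mul_self (r : Fin 3 → ℝ) : kerProj r * kerProj r = kerProj r := by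
  simp [kerProj, Matrix.diagonal_mul_diagonal]

theorem kerProj_mul_single {r : Fin 3 → ℝ} {j : Fin 3} (h : r j = 0) :
    kerProj r * Matrix.single j j 1 = Matrix.single j j 1 := by
  ext i l
  rw [kerProj, Matrix.diagonal_mul]
  by_cases hi : j = i
  · subst hi; simp [h]
  · simp [Matrix.single, hi]

theorem expDiag_tendsto {r : Fin 3 → ℝ} (hr : ∀ i, r i ≤ 0) :
    Tendsto (expDiag fun i => r i) atTop (𝓝 (kerProj r)) := by
  have hd : Continuous fun w : Fin 3 → ℂ => (Matrix.diagonal w : Mat3) :=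
    (LinearMap.toContinuousLinearMap (Matrix.diagonalLinearMap (Fin 3) ℝ ℂ)).continuous
  refine (hd.tendsto _).comp (tendsto_pi_nhds.2 fun i => ?_)
  rcases (hr i).lt_or_eq with h | h
  · simp only [h.ne, if_false]
    rw [tendsto_zero_iff_norm_tendsto_zero]
    have : ∀ s : ℝ, ‖exp ((r i : ℂ) * s)‖ = Real.exp (r i * s) := fun s => by
      rw [← ofReal_mul, norm_exp_ofReal]
    simp only [this]
    exact Real.tendsto_exp_atBot.comp (tendsto_id.const_mul_atTop_of_neg h)
  · simp [h]

/-- The fundamental matrix `H` has a limit of the form `P U`, with `P` the projection onto the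
kernel of the diagonal part and `U` invertible. Every basis vector in the range of `P` is thus the
limit of some solution. -/
theorem IsPrimitive.exists_tendsto_single {r : Fin 3 → ℝ} (hr : ∀ i, r i ≤ 0) {R H : ℝ → Mat3}
    (hH : IsPrimitive H fun s => (Matrix.diagonal (fun i => (r i : ℂ)) + R s) * H s)
    (hR : LocallyIntegrable R) {τ : ℝ → ℝ} (hτ : Tendsto τ atTop (𝓝 0))
    (hRτ : ∀ a s, a ≤ s → ∫ x in a..s, ‖R x‖ ≤ τ a) {s₀ : ℝ} (hH0 : H s₀ = 1)
    (hs₀ : τ s₀ ≤ 1 / 8) {j : Fin 3} (hj : r j = 0) :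
    ∃ c, Tendsto (fun s => H s * c) atTop (𝓝 (Matrix.single j j 1)) := by
  have hd : ∀ i, ((r i : ℂ)).re ≤ 0 := fun i => by simpa using hr i
  have hbd : ∀ s, s₀ ≤ s → ‖H s‖ ≤ 2 := by
    intro s hs
    have := hH.norm_sub_le hd hR (c := 0) (by simp) hs ((hRτ _ _ hs).trans (by linarith))
    simpa [hH0] using this
  have hvar : ∀ a s, s₀ ≤ a → a ≤ s →
      ‖H s - expDiag (fun i => r i) (s - a) * H a‖ ≤ 2 * τ a := by
    intro a s ha has
    refine (hH.norm_sub_expDiag_le hd hR has).trans ?_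
    calc _ ≤ ∫ x in a..s, ‖R x‖ * 2 := by
          refine intervalIntegral.integral_mono_on has
            ((hR.norm_comp.intervalIntegrable_of _ _).mul_continuousOn
              hH.continuous.norm.continuousOn)
            ((hR.norm_comp.intervalIntegrable_of _ _).mul_const _) fun x hx => ?_
          gcongr
          exact hbd x (ha.trans hx.1)
      _ ≤ 2 * τ a := by
          rw [intervalIntegral.integral_mul_const, mul_comm]
          gcongr
          exact hRτ _ _ has
  have hexp : ∀ a, Tendsto (fun s => expDiag (fun i => (r i : ℂ)) (s - a) * H a) atTop
      (𝓝 (kerProj r * H a)) := fun a =>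
    ((expDiag_tendsto hr).comp (tendsto_atTop_add_const_right _ (-a) tendsto_id)).mul_const _
  -- For fixed `a`, `H s` stays within `2 τ(a)` of a function of `s` that converges to `P H(a)`;
  -- hence `H` is Cauchy.
  obtain ⟨L, hL⟩ : ∃ L, Tendsto H atTop (𝓝 L) := by
    rw [← cauchy_map_iff_exists_tendsto, Metric.cauchy_iff]
    refine ⟨inferInstance, fun ε hε => ?_⟩
    have h2 := (hτ.const_mul 2)
    rw [mul_zero] at h2
    obtain ⟨a, ha, ha'⟩ := ((eventually_ge_atTop s₀).and
      (h2.eventually_lt_const (by positivity : 0 < ε / 4))).exists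
    obtain ⟨s₁, hs₁⟩ := eventually_atTop.1
      (((hexp a).eventually (Metric.ball_mem_nhds _ (by positivity : 0 < ε / 4))).and
        (eventually_ge_atTop a))
    have hnear : ∀ s, s₁ ≤ s → dist (H s) (kerProj r * H a) < ε / 2 := by
      intro s hs
      obtain ⟨h3, h4⟩ := hs₁ s hs
      have h5 := hvar a s ha h4
      rw [← dist_eq_norm] at h5
      calc _ ≤ _ := dist_triangle _ _ _
        _ < ε / 4 + ε / 4 := add_lt_add (h5.trans_lt ha') h3
        _ = ε / 2 := by ring
    refine ⟨H '' Set.Ici s₁, image_mem_map (Ici_mem_atTop s₁), ?_⟩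
    rintro _ ⟨s, hs, rfl⟩ _ ⟨s', hs', rfl⟩
    calc _ ≤ _ := dist_triangle_right _ _ (kerProj r * H a)
      _ < ε / 2 + ε / 2 := add_lt_add (hnear s hs) (hnear s' hs')
      _ = ε := by ring
  have hLa : ∀ a, s₀ ≤ a → ‖L - kerProj r * H a‖ ≤ 2 * τ a := fun a ha =>
    le_of_tendsto (hL.sub (hexp a)).norm
      ((eventually_ge_atTop a).mono fun s hs => hvar a s ha hs)
  have hPL : kerProj r * L = L := by
    have h1 : Tendsto (fun a => ‖L - kerProj r * H a‖) atTop (𝓝 0) :=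
      squeeze_zero' (Eventually.of_forall fun _ => norm_nonneg _)
        ((eventually_ge_atTop s₀).mono hLa) (by simpa using hτ.const_mul 2)
    have h2 := tendsto_nhds_unique h1 ((hL.const_mul (kerProj r)).const_sub L).norm
    exact (sub_eq_zero.1 (norm_eq_zero.1 h2.symm)).symm
  -- At `a = s₀`, where `H = 1`, the bound `1 / 8` gives distance at most `1 / 4` from `L` to `P`.
  -- So `1 + (L - P)` is invertible, and `P (1 + (L - P)) = L` because `P L = L`.
  have hX : ‖-(L - kerProj r)‖ < 1 := by
    have := hLa s₀ le_rfl
    rw [hH0, mul_one] at this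
    rw [norm_neg]
    linarith
  obtain ⟨U, hU⟩ : ∃ U : Mat3ˣ, (U : Mat3) = 1 + (L - kerProj r) :=
    ⟨Units.oneSub _ hX, by rw [Units.val_oneSub, sub_neg_eq_add]⟩
  have hLU : L = kerProj r * U := by
    rw [hU, mul_add, mul_sub, hPL, kerProj_mul_self, mul_one]
    abel
  have e : L * (((U⁻¹ : Mat3ˣ) : Mat3) * Matrix.single j j 1) = Matrix.single j j 1 := by
    rw [hLU, mul_assoc, Units.mul_inv_cancel_left, kerProj_mul_single hj]
  exact ⟨_, e ▸ hL.mul_const (((U⁻¹ : Mat3ˣ) : Mat3) * Matrix.single j j 1)⟩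

variable {q0 : ℝ} {u : ℝ → Vec2} {z : ℂ} {v : Vec2} {j : Fin 3}

/-- The opposite of the imaginary parts of `d`. -/
def oscPart (d : Fin 3 → ℂ) (i : Fin 3) : ℂ := -(I * (d i).im)

theorem norm_expDiag_oscPart_le (d : Fin 3 → ℂ) (s : ℝ) : ‖expDiag (oscPart d) s‖ ≤ 1 :=
  norm_expDiag_le fun i => by simp [oscPart]

theorem expDiag_mul_expDiag_neg (d : Fin 3 → ℂ) (s : ℝ) : expDiag d s * expDiag d (-s) = 1 := by
  rw [expDiag_mul, add_neg_cancel, expDiag_zero]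

theorem expDiag_neg_mul_expDiag (d : Fin 3 → ℂ) (s : ℝ) : expDiag d (-s) * expDiag d s = 1 := by
  rw [expDiag_mul, neg_add_cancel, expDiag_zero]

/-- Imaginary parts of the exponents would leave oscillations with no limit. The rotation removes
them, and neither it nor its inverse increases norms. -/
theorem expDiag_oscPart_gauge {d : Fin 3 → ℂ} {R h : ℝ → Mat3}
    (hh : IsPrimitive h fun x => (Matrix.diagonal d + R x) * h x) :
    IsPrimitive (fun x => expDiag (oscPart d) x * h x) fun x =>
      (Matrix.diagonal (fun i => ((d i).re : ℂ)) +
        expDiag (oscPart d) x * R x * expDiag (oscPart d) (-x)) *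
        (expDiag (oscPart d) x * h x) := by
  have hE : IsPrimitive (expDiag (oscPart d))
      fun s => Matrix.diagonal (oscPart d) * expDiag (oscPart d) s :=
    IsPrimitive.of_hasDerivAt (expDiag_hasDerivAt _)
      (continuous_const.mul (expDiag_continuous _))
  convert! hE.mul hh using 2
  rename_i x
  have e1 : (Matrix.diagonal (fun i => ((d i).re : ℂ)) : Mat3) =
      Matrix.diagonal (oscPart d) + Matrix.diagonal d := by
    rw [Matrix.diagonal_add]
    congr 1
    funext i
    apply Complex.ext <;> simp [oscPart]
  have e2 : expDiag (oscPart d) x * Matrix.diagonal d =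
      Matrix.diagonal d * expDiag (oscPart d) x := by
    simp only [expDiag, Matrix.diagonal_mul_diagonal, mul_comm]
  rw [e1, add_mul, add_mul, add_mul, mul_add, ← mul_assoc _ (Matrix.diagonal d), e2]
  simp only [mul_assoc]
  rw [← mul_assoc (expDiag (oscPart d) (-x)), expDiag_neg_mul_expDiag, one_mul]
  abel

/-- At `-∞` there is a solution with each dominant asymptotic behaviour. -/
theorem exists_dominant (hv : ‖v‖ = q0) (hq : q0 ≠ 0)
    (hB : ∀ a : ℝ, IntegrableOn (fun x => u x - v) (Set.Iio a)) (hz : z ≠ 0)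
    (hw : z ^ 2 + (q0 : ℂ) ^ 2 ≠ 0) (hre : ∀ i, (expo q0 z j).re ≤ (expo q0 z i).re) :
    ∃ ψ, IsLaxSol q0 u z ψ ∧ Tendsto (fun x : ℝ => exp (-(expo q0 z j * x)) • ψ x) atBot
      (𝓝 (matY q0 v z * Matrix.single j j 1)) := by
  have hu := locallyIntegrable_of_Iio hB
  set C := ‖matYInv q0 v z‖ * ‖matY q0 v z‖ with hC
  -- The factor `4` turns the bound `1 / 2` into the `1 / 8` required by the convergence lemma.
  obtain ⟨x₀, hx₀⟩ := exists_tailNorm_le hB (4 * C)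
  set d : Fin 3 → ℂ := fun i => expo q0 z i - expo q0 z j with hd
  set E := expDiag (oscPart d) with hE
  -- Chosen so that the gauged and rotated solution equals `1` at `x₀`.
  set M : Mat3 := laxFundInv q0 u z x₀ * (exp (expo q0 z j * x₀) • (matY q0 v z * E (-x₀)))
    with hM
  set φ : ℝ → Mat3 := fun x => laxFund q0 u z x * M with hφ
  have hsol : IsLaxSol q0 u z φ := (laxFund_isLaxSol hu z).mul_const M
  have hW := expDiag_oscPart_gauge (hsol.isPrimitive_gauged hv hq hz hw j)
  have hW0 : E x₀ * gauged q0 v z j φ x₀ = 1 := by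
    rw [gauged, hφ]
    simp only [hM]
    rw [← mul_assoc (laxFund q0 u z x₀), laxFund_mul_laxFundInv hu, one_mul,
      Matrix.mul_smul (matYInv q0 v z), smul_smul, ← Complex.exp_add, neg_add_cancel,
      Complex.exp_zero, one_smul, ← mul_assoc (matYInv q0 v z), matYInv_mul_matY hv hq hz hw,
      one_mul, hE, expDiag_mul_expDiag_neg]
  set r : Fin 3 → ℝ := fun i => -(d i).re with hr
  -- Reversing `x` changes the signs of the real parts, so a dominant exponent gives a dissipative
  -- system towards `+∞`.
  have hH : IsPrimitive (fun s => E (-s) * gauged q0 v z j φ (-s)) fun s =>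
      (Matrix.diagonal (fun i => (r i : ℂ)) + -(E (-s) * pert q0 u v z (-s) * E (- -s))) *
        (E (-s) * gauged q0 v z j φ (-s)) := by
    convert! hW.comp_neg using 2
    have e : (Matrix.diagonal (fun i => (r i : ℂ)) : Mat3) =
        -Matrix.diagonal (fun i => ((d i).re : ℂ)) := by
      rw [Matrix.diagonal_neg]
      congr 1
      funext i
      simp [hr]
    rw [e, ← neg_add, neg_mul]
  have hR : LocallyIntegrable fun s => -(E (-s) * pert q0 u v z (-s) * E (- -s)) := by
    have hc := expDiag_continuous (oscPart d)
    have h1 : LocallyIntegrable fun x => E x * pert q0 u v z x * E (-x) :=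
      ((locallyIntegrable_pert hu).cont_mul hc).mul_cont (hc.comp continuous_neg)
    exact ((h1.isPrimitive 0).comp_neg).locInt
  have hC0 : 0 ≤ C := by positivity
  have hτ : Tendsto (fun s => C * tailNorm u v (-s)) atTop (𝓝 0) := by
    simpa using ((tailNorm_tendsto hB).comp tendsto_neg_atTop_atBot).const_mul C
  have hRτ : ∀ a s, a ≤ s → ∫ x in a..s, ‖-(E (-x) * pert q0 u v z (-x) * E (- -x))‖ ≤
      C * tailNorm u v (-a) := by
    intro a s has
    have h2 := integral_pert_le hB (z := z) hC.ge (neg_le_neg has)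
    refine le_trans ?_ h2
    rw [← intervalIntegral.integral_comp_neg fun x => ‖pert q0 u v z x‖]
    have hi : IntervalIntegrable (fun x => ‖pert q0 u v z (-x)‖) volume a s := by
      have := ((locallyIntegrable_pert (q0 := q0) (v := v) (z := z) hu).isPrimitive
        0).comp_neg.locInt.norm_comp.intervalIntegrable_of a s
      simpa only [norm_neg] using this
    refine intervalIntegral.integral_mono_on has (hR.norm_comp.intervalIntegrable_of _ _)
      hi fun x _ => ?_
    rw [norm_neg]
    calc _ ≤ ‖E (-x)‖ * ‖pert q0 u v z (-x)‖ * ‖E (- -x)‖ :=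
            (norm_mul_le _ _).trans (by gcongr; exact norm_mul_le _ _)
        _ ≤ 1 * ‖pert q0 u v z (-x)‖ * 1 := by
            gcongr <;> exact norm_expDiag_oscPart_le d _
        _ = _ := by ring
  obtain ⟨c, hc⟩ := hH.exists_tendsto_single (r := r) (j := j) (s₀ := -x₀)
    (fun i => by simpa [hr, hd] using hre i) hR hτ hRτ (by simpa using hW0)
    (by rw [neg_neg]; linarith) (by simp [hr, hd])
  refine ⟨fun x => φ x * c, hsol.mul_const c, ?_⟩
  have hc' := hc.comp tendsto_neg_atBot_atTop
  simp only [Function.comp_def, neg_neg] at hc'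
  have hg : Tendsto (gauged q0 v z j fun x => φ x * c) atBot (𝓝 (Matrix.single j j 1)) := by
    rw [tendsto_iff_norm_sub_tendsto_zero] at hc' ⊢
    refine squeeze_zero (fun _ => norm_nonneg _) (fun x => ?_) hc'
    -- The `j`-th shifted exponent is `0`, so the rotation fixes this basis vector and can be undone
    -- in the limit.
    have e1 : E (-x) * Matrix.single j j 1 = Matrix.single j j 1 := by
      refine expDiag_mul_of_kernel ?_ _
      ext i l
      rw [Matrix.diagonal_mul]
      by_cases hi : j = i
      · subst hi; simp [oscPart, hd]
      · simp [Matrix.single, hi]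
    have e2 : gauged q0 v z j (fun x => φ x * c) x - Matrix.single j j 1 =
        E (-x) * (E x * gauged q0 v z j φ x * c - Matrix.single j j 1) := by
      rw [mul_sub, e1, mul_assoc, ← mul_assoc (E (-x)), hE, expDiag_neg_mul_expDiag, one_mul]
      simp only [gauged, Matrix.smul_mul, mul_assoc]
    rw [e2]
    exact (norm_mul_le _ _).trans
      (mul_le_of_le_one_left (norm_nonneg _) (norm_expDiag_oscPart_le d _))
  exact (hg.const_mul (matY q0 v z)).congr fun x => matY_mul_gauged hv hq hz hw x

end Dominant

/-! ### Ordering of the exponents and existence of Jost eigenfunctions. -/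

section Jost

variable {q0 : ℝ} {u : ℝ → Vec2} {z : ℂ} {v : Vec2} {j : Fin 3}

theorem lamOf_im (q0 : ℝ) (z : ℂ) :
    (lamOf q0 z).im = z.im * (1 - q0 ^ 2 / normSq z) / 2 := by
  have h : ((q0 : ℂ) ^ 2 / z).im = -(q0 ^ 2 * z.im / normSq z) := by
    rw [← ofReal_pow, div_eq_mul_inv, im_ofReal_mul, inv_im]
    ring
  rw [lamOf, show (2 : ℂ) = ((2 : ℝ) : ℂ) by norm_num, div_ofReal_im, add_im, h]
  ring

theorem kOf_im (q0 : ℝ) (z : ℂ) :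
    (kOf q0 z).im = z.im * (1 + q0 ^ 2 / normSq z) / 2 := by
  have h : ((q0 : ℂ) ^ 2 / z).im = -(q0 ^ 2 * z.im / normSq z) := by
    rw [← ofReal_pow, div_eq_mul_inv, im_ofReal_mul, inv_im]
    ring
  rw [kOf, show (2 : ℂ) = ((2 : ℝ) : ℂ) by norm_num, div_ofReal_im, sub_im, h]
  ring

theorem expo_re_zero (q0 : ℝ) (z : ℂ) : (expo q0 z 0).re = (lamOf q0 z).im := by simp [expo]

theorem expo_re_one (q0 : ℝ) (z : ℂ) : (expo q0 z 1).re = -(kOf q0 z).im := by simp [expo]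

theorem expo_re_two (q0 : ℝ) (z : ℂ) : (expo q0 z 2).re = -(lamOf q0 z).im := by simp [expo]

theorem sq_add_sq_ne_zero (h1 : z ≠ I * q0) (h2 : z ≠ -(I * q0)) :
    z ^ 2 + (q0 : ℂ) ^ 2 ≠ 0 := by
  have e : z ^ 2 + (q0 : ℂ) ^ 2 = (z - I * q0) * (z + I * q0) := by
    linear_combination ((q0 : ℂ) ^ 2) * I_sq
  rw [e]
  refine mul_ne_zero (sub_ne_zero.2 h1) fun h => h2 (eq_neg_of_add_eq_zero_left h)

/-- The set on which the `j`-th exponential is the most recessive one at `-∞`; for `j = 1` it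
contains the branch point `-i q₀`. -/
def recDomain (q0 : ℝ) : Fin 3 → Set ℂ :=
  ![{z | 0 ≤ z.im ∧ q0 ≤ ‖z‖ ∧ z ≠ 0 ∧ z ≠ I * q0}, {z | z.im ≤ 0 ∧ z ≠ 0},
    {z | 0 ≤ z.im ∧ ‖z‖ ≤ q0 ∧ z ≠ 0 ∧ z ≠ I * q0}]

theorem ne_zero_of_mem_recDomain (h : z ∈ recDomain q0 j) : z ≠ 0 := by
  fin_cases j
  · exact h.2.2.1
  · exact h.2
  · exact h.2.2.1

/-- The real parts are `Im λ`, `-Im k`, `-Im λ`, where `Im k` and `Im λ` are `Im z / 2` times `1 +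
q₀²/|z|²` and `1 - q₀²/|z|²`. The order is read off from the sign of `Im z` and the comparison of
`|z|` with `q₀`. -/
theorem isRecessive_of_mem_recDomain (hq : 0 < q0) (h : z ∈ recDomain q0 j)
    (h' : z ≠ -(I * q0)) : IsRecessive q0 j z := by
  have hz := ne_zero_of_mem_recDomain h
  have hn : 0 < normSq z := normSq_pos.2 hz
  have hn' : normSq z = ‖z‖ ^ 2 := normSq_eq_norm_sq z
  have hp : 0 < q0 ^ 2 / normSq z := by positivity
  refine ⟨hz, sq_add_sq_ne_zero ?_ h', ?_⟩
  · fin_cases j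
    · exact h.2.2.2
    · rintro rfl
      have h1 := h.1
      simp at h1
      linarith
    · exact h.2.2.2
  · suffices (expo q0 z 0).re ≤ (expo q0 z j).re ∧ (expo q0 z 1).re ≤ (expo q0 z j).re ∧
        (expo q0 z 2).re ≤ (expo q0 z j).re by
      intro i
      fin_cases i
      exacts [this.1, this.2.1, this.2.2]
    fin_cases j
    · have h1 : 0 ≤ z.im := h.1
      have h2 : q0 ≤ ‖z‖ := h.2.1
      have h3 : q0 ^ 2 / normSq z ≤ 1 := by
        rw [div_le_one hn, hn']
        gcongr
      simp only [expo_re_zero, expo_re_one, expo_re_two, lamOf_im, kOf_im, Fin.mk_zero,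
        Fin.isValue]
      refine ⟨le_rfl, ?_, ?_⟩ <;> nlinarith
    · have h1 : z.im ≤ 0 := h.1
      simp only [expo_re_zero, expo_re_one, expo_re_two, lamOf_im, kOf_im, Fin.mk_one, Fin.isValue]
      refine ⟨?_, le_rfl, ?_⟩ <;> nlinarith
    · have h1 : 0 ≤ z.im := h.1
      have h2 : ‖z‖ ≤ q0 := h.2.1
      have h3 : 1 ≤ q0 ^ 2 / normSq z := by
        rw [one_le_div hn, hn']
        gcongr
      simp only [expo_re_zero, expo_re_one, expo_re_two, lamOf_im, kOf_im, Fin.reduceFinMk,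
        Fin.isValue]
      refine ⟨?_, ?_, le_rfl⟩ <;> nlinarith

theorem contSpec_ne (h : z ∈ contSpec q0) : z ≠ 0 ∧ z ≠ I * q0 ∧ z ≠ -(I * q0) := by
  simpa [contSpec, singularPts] using h.2

/-- On the real axis all three real parts vanish. On the circle `Im λ = 0`, so the outer two vanish
and the middle one is extremal, on a side given by the sign of `Im z`. -/
theorem contSpec_recessive_or_dominant (hq : 0 < q0) (h : z ∈ contSpec q0) (j : Fin 3) :
    IsRecessive q0 j z ∨ ∀ i, (expo q0 z j).re ≤ (expo q0 z i).re := by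
  obtain ⟨h0, h1, h2⟩ := contSpec_ne h
  rcases h.1 with him | hnorm
  · have e : ∀ i, (expo q0 z i).re = 0 := by
      intro i
      fin_cases i <;> simp [expo, lamOf_im, kOf_im, him]
    exact Or.inr fun i => by rw [e, e]
  · rcases le_total 0 z.im with him | him
    · have hd : ∀ i, (expo q0 z 1).re ≤ (expo q0 z i).re := by
        have hn : normSq z = q0 ^ 2 := by rw [normSq_eq_norm_sq, hnorm]
        intro i
        have hq2 : q0 ^ 2 / q0 ^ 2 = 1 := div_self (by positivity)
        fin_cases i <;> simp [expo_re_zero, expo_re_one, expo_re_two, lamOf_im, kOf_im, hn, hq2] <;>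
          linarith
      fin_cases j
      · exact Or.inl (isRecessive_of_mem_recDomain (j := 0) hq ⟨him, hnorm.ge, h0, h1⟩ h2)
      · exact Or.inr hd
      · exact Or.inl (isRecessive_of_mem_recDomain (j := 2) hq ⟨him, hnorm.le, h0, h1⟩ h2)
    · have hn : normSq z = q0 ^ 2 := by rw [normSq_eq_norm_sq, hnorm]
      have hq2 : q0 ^ 2 / q0 ^ 2 = 1 := div_self (by positivity)
      fin_cases j
      · refine Or.inr fun i => ?_
        fin_cases i <;> simp [expo_re_zero, expo_re_one, expo_re_two, lamOf_im, kOf_im, hn, hq2]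
        all_goals linarith
      · exact Or.inl (isRecessive_of_mem_recDomain (j := 1) hq ⟨him, h0⟩ h2)
      · refine Or.inr fun i => ?_
        fin_cases i <;> simp [expo_re_zero, expo_re_one, expo_re_two, lamOf_im, kOf_im, hn, hq2]
        all_goals linarith

/-- An entry of a matrix, as a continuous linear map. -/
def entryL (i j : Fin 3) : Mat3 →L[ℂ] ℂ :=
  LinearMap.toContinuousLinearMap (Matrix.entryLinearMap ℂ ℂ i j)

theorem integral_mat_apply {f : ℝ → Mat3} {a b : ℝ} (hf : IntervalIntegrable f volume a b)
    (i j : Fin 3) : (∫ r in a..b, f r) i j = ∫ r in a..b, f r i j :=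
  (((entryL i j).restrictScalars ℝ).intervalIntegral_comp_comm hf).symm

theorem locallyIntegrable_laxA (hu : LocallyIntegrable u) (z : ℂ) :
    LocallyIntegrable fun x => laxA q0 z (u x) :=
  (continuous_const (y := (-(I * kOf q0 z)) • matJ)).locallyIntegrable.add (hu.clm matQL)

theorem solvesLaxX_iff (hu : LocallyIntegrable u) {ψ : ℝ → Mat3} :
    SolvesLaxX q0 u z ψ ↔ IsLaxSol q0 u z ψ := by
  constructor
  · rintro ⟨hc, h⟩
    have hc' : Continuous ψ := hc
    have hl := (locallyIntegrable_laxA (q0 := q0) hu z).mul_cont hc'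
    refine ⟨hl, fun x y => ?_⟩
    ext i j
    rw [integral_mat_apply (hl.intervalIntegrable_of x y), Matrix.sub_apply, h x y i j]
    ring
  · intro h
    refine ⟨h.continuous, fun x y i j => ?_⟩
    rw [← integral_mat_apply (h.locInt.intervalIntegrable_of x y), ← h.sub_eq, Matrix.sub_apply]
    ring

theorem diagonal_mul_single_self (d : Fin 3 → ℂ) (j : Fin 3) :
    Matrix.diagonal d * Matrix.single j j (1 : ℂ) = d j • Matrix.single j j 1 := by
  ext i l
  rw [Matrix.diagonal_mul]
  by_cases hi : j = i
  · subst hi; simp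
  · simp [Matrix.single, hi]

theorem single_mul_diagonal_self (d : Fin 3 → ℂ) (j : Fin 3) :
    Matrix.single j j (1 : ℂ) * Matrix.diagonal d = d j • Matrix.single j j 1 := by
  ext i l
  rw [Matrix.mul_diagonal]
  by_cases hl : j = l
  · subst hl; simp [mul_comm]
  · simp [Matrix.single, hl]

/-- The `j`-th column of `matY`. -/
def colY (q0 : ℝ) (v : Vec2) (j : Fin 3) (z : ℂ) : Mat3 := matY q0 v z * Matrix.single j j 1

theorem laxA_mul_colY (hv : ‖v‖ = q0) (hq : q0 ≠ 0) (hz : z ≠ 0) :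
    laxA q0 z v * colY q0 v j z = expo q0 z j • colY q0 v j z := by
  rw [colY, ← mul_assoc, laxA_mul_matY hv hq hz, mul_assoc, diagonal_mul_single_self,
    Matrix.mul_smul]

theorem exists_column (hv : ‖v‖ = q0) (hq : 0 < q0)
    (hB : ∀ a : ℝ, IntegrableOn (fun x => u x - v) (Set.Iio a)) (hz : z ∈ contSpec q0)
    (j : Fin 3) :
    ∃ ψ, IsLaxSol q0 u z ψ ∧ Tendsto (fun x : ℝ => exp (-(expo q0 z j * x)) • ψ x) atBot
      (𝓝 (colY q0 v j z)) := by
  obtain ⟨h0, h1, h2⟩ := contSpec_ne hz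
  rcases contSpec_recessive_or_dominant hq hz j with h | h
  · have hu := locallyIntegrable_of_Iio hB
    exact ⟨_, (laxFund_isLaxSol hu z).mul_const _,
      colLimit_asymptotics hv hq.ne' hB h (laxA_mul_colY hv hq.ne' h0)⟩
  · exact exists_dominant hv hq.ne' hB h0 (sq_add_sq_ne_zero h1 h2) h

theorem sum_single_eq_one : ∑ j : Fin 3, Matrix.single j j (1 : ℂ) = 1 :=
  (Matrix.sum_single_eq_diagonal _).trans Matrix.diagonal_one

theorem IsPrimitive.finsetSum {f f' : Fin 3 → ℝ → Mat3} (h : ∀ j, IsPrimitive (f j) (f' j)) :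
    IsPrimitive (fun x => ∑ j, f j x) fun x => ∑ j, f' j x := by
  simp only [Fin.sum_univ_three]
  exact ((h 0).add (h 1)).add (h 2)

/-- Jost eigenfunctions exist at the left end. -/
theorem exists_isJost_atBot (σ t : ℝ) (hv : ‖v‖ = q0) (hq : 0 < q0)
    (hB : ∀ a : ℝ, IntegrableOn (fun x => u x - v) (Set.Iio a)) (hz : z ∈ contSpec q0) :
    ∃ ψ, IsJost σ q0 u t atBot v z ψ := by
  have hu := locallyIntegrable_of_Iio hB
  choose ψ hψ hlim using exists_column hv hq hB hz
  set c : Fin 3 → ℂ := fun j => exp (I * phase σ q0 0 t z j) with hc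
  refine ⟨fun x => ∑ j, ψ j x * (c j • Matrix.single j j 1), (solvesLaxX_iff hu).2 ?_, ?_⟩
  · unfold IsLaxSol
    simp only [Finset.mul_sum]
    exact IsPrimitive.finsetSum fun j => (hψ j).mul_const _
  · have h := tendsto_finsetSum Finset.univ fun j _ =>
      (hlim j).mul_const (Matrix.single j j (1 : ℂ))
    have e : ∑ j : Fin 3, colY q0 v j z * Matrix.single j j (1 : ℂ) =
        matY q0 v z := by
      simp only [colY, mul_assoc, Matrix.single_mul_single_same, mul_one]
      rw [← Finset.mul_sum, sum_single_eq_one, mul_one]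
    rw [e] at h
    refine h.congr fun x => ?_
    rw [Finset.sum_mul]
    refine Finset.sum_congr rfl fun j _ => ?_
    rw [mul_assoc (ψ j x), Matrix.smul_mul (c j), single_mul_diagonal_self, smul_smul, hc, ← Complex.exp_add, phase_eq σ q0 x,
      Matrix.mul_smul, Matrix.smul_mul]
    congr 2
    ring

/-- Reflection exchanges the ends of the line. -/
theorem IsJost.reflect {σ t : ℝ} {l l' : Filter ℝ} {ψ : ℝ → Mat3} (hu : LocallyIntegrable u)
    (h : IsJost σ q0 u t l v z ψ) (hl : Tendsto (fun x : ℝ => -x) l' l) :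
    IsJost σ q0 (fun x => -u (-x)) t l' (-v) (-z) (fun x => ψ (-x) * matJ) := by
  have hu' : LocallyIntegrable fun x => -u (-x) := (hu.isPrimitive 0).comp_neg.locInt
  have hs := (solvesLaxX_iff hu).1 h.1
  refine ⟨(solvesLaxX_iff hu').2 ?_, ?_⟩
  · refine IsLaxSol.mul_const ?_ _
    unfold IsLaxSol
    simp only [laxA_neg, neg_mul]
    exact IsPrimitive.comp_neg hs
  · have h2 : Tendsto (fun x => ψ x * Matrix.diagonal fun j => exp (-(I * phase σ q0 x t z j))) l
      (𝓝 (matY q0 v z)) := h.2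
    have h3 := (h2.comp hl).mul_const matJ
    rw [matY_neg]
    refine h3.congr fun x => ?_
    have e : phase σ q0 x t (-z) = phase σ q0 (-x) t z := by
      rw [← phase_neg σ q0 (-x) t z, neg_neg]
    simp only [Function.comp, e, matJ, mul_assoc, Matrix.diagonal_mul_diagonal, mul_comm]

end Jost

/-- A sequence of holomorphic functions that converges locally uniformly off a point also converges
locally uniformly at that point. -/
theorem TendstoLocallyUniformlyOn.of_diff_singleton {E : Type*} [NormedAddCommGroup E]
    [NormedSpace ℂ E] [CompleteSpace E] {F : ℕ → ℂ → E} {f : ℂ → E} {D : Set ℂ} {p : ℂ} {r : ℝ}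
    (hr : 0 < r) (hsub : Metric.closedBall p r ⊆ D)
    (h : TendstoLocallyUniformlyOn F f atTop (D \ {p}))
    (hd : ∀ n, DifferentiableOn ℂ (F n) (Metric.closedBall p r))
    (hlim : CauchySeq (fun n => F n p) → Tendsto (fun n => F n p) atTop (𝓝 (f p))) :
    TendstoLocallyUniformlyOn F f atTop D := by
  have hsphere : Metric.sphere p r ⊆ D \ {p} := fun z hz =>
    ⟨hsub (Metric.sphere_subset_closedBall hz), Metric.ne_of_mem_sphere hz hr.ne'⟩
  have hs := ((tendstoLocallyUniformlyOn_iff_tendstoUniformlyOn_of_compact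
    (isCompact_sphere p r)).1 (h.mono hsphere)).uniformCauchySeqOn
  have hb : UniformCauchySeqOn F atTop (Metric.closedBall p r) := by
    rw [Metric.uniformCauchySeqOn_iff] at hs ⊢
    intro ε hε
    obtain ⟨N, hN⟩ := hs (ε / 2) (by positivity)
    refine ⟨N, fun m hm n hn z hz => ?_⟩
    rw [dist_eq_norm]
    -- The maximum principle for `F m - F n` carries the uniform Cauchy estimate from the circle to
    -- the disc.
    refine lt_of_le_of_lt ?_ (half_lt_self hε)
    refine Complex.norm_le_of_forall_mem_frontier_norm_le (f := fun z => F m z - F n z)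
      (Metric.isBounded_ball (x := p) (r := r)) ?_ (fun w hw => ?_)
      (by rwa [closure_ball _ hr.ne'])
    · refine DifferentiableOn.diffContOnCl ?_
      rw [closure_ball _ hr.ne']
      exact (hd m).sub (hd n)
    · rw [frontier_ball _ hr.ne'] at hw
      rw [← dist_eq_norm]
      exact (hN m hm n hn w hw).le
  have hpt : ∀ z ∈ Metric.closedBall p r, Tendsto (fun n => F n z) atTop (𝓝 (f z)) := by
    intro z hz
    by_cases hzp : z = p
    · subst hzp
      exact hlim (hb.cauchySeq hz)
    · exact h.tendsto_at ⟨hsub hz, hzp⟩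
  have hu := (hb.tendstoUniformlyOn_of_tendsto hpt).tendstoLocallyUniformlyOn
  rw [tendstoLocallyUniformlyOn_iff_forall_tendsto] at h hu ⊢
  intro z hz
  by_cases hzp : z = p
  · subst hzp
    have := hu z (Metric.mem_closedBall_self hr.le)
    rw [nhdsWithin_eq_nhds.2 (Metric.closedBall_mem_nhds z hr)] at this
    exact this.mono_left (prod_mono le_rfl nhdsWithin_le_nhds)
  · have := h z ⟨hz, hzp⟩
    have e : 𝓝[D \ {p}] z = 𝓝[D] z := by
      rw [Set.sdiff_eq]
      exact nhdsWithin_inter_of_mem' (mem_nhdsWithin_of_mem_nhds (isOpen_ne.mem_nhds hzp))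
    rwa [e] at this

/-! ### Holomorphy of the limits, including the branch point, and the adjoint potential. -/

section Scattering

variable {q0 : ℝ} {u : ℝ → Vec2} {z : ℂ} {v vm vp : Vec2} {j : Fin 3} {y : ℂ → Mat3}

theorem colApprox_differentiableAt (hu : LocallyIntegrable u) (hz : z ≠ 0)
    (hy : DifferentiableAt ℂ y z) (a : ℝ) : DifferentiableAt ℂ (colApprox q0 u j y a) z :=
  (laxFundInv_differentiableAt hu a hz).mul
    ((((differentiableAt_expo q0 j hz).mul_const _).cexp).smul hy)

theorem closedBall_subset_recDomain (hq : 0 < q0) :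
    Metric.closedBall (-(I * q0)) (q0 / 2) ⊆ recDomain q0 1 := by
  intro z hz
  rw [mem_closedBall_iff_norm] at hz
  have h1 := (abs_im_le_norm _).trans hz
  rw [sub_neg_eq_add, add_im, show (I * (q0 : ℂ)).im = q0 by simp] at h1
  have h2 : z.im < 0 := by linarith [(abs_le.1 h1).2]
  exact ⟨h2.le, fun h => by simp [h] at h2⟩

theorem colLimit_tendstoLocallyUniformlyOn_recDomain (hv : ‖v‖ = q0) (hq : 0 < q0)
    (hB : ∀ a : ℝ, IntegrableOn (fun x => u x - v) (Set.Iio a))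
    (hyd : ∀ z ∈ recDomain q0 j, DifferentiableAt ℂ y z)
    (hy : ∀ z ∈ recDomain q0 j, z ≠ -(I * q0) → laxA q0 z v * y z = expo q0 z j • y z) :
    TendstoLocallyUniformlyOn (fun (n : ℕ) z => colApprox q0 u j y (-n) z)
      (colLimit q0 u j y) atTop (recDomain q0 j) := by
  have hu := locallyIntegrable_of_Iio hB
  have h : TendstoLocallyUniformlyOn (fun (n : ℕ) z => colApprox q0 u j y (-n) z)
      (colLimit q0 u j y) atTop (recDomain q0 j \ {-(I * (q0 : ℂ))}) :=
    colLimit_tendstoLocallyUniformlyOn hv hq.ne' hB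
      (fun z hz => isRecessive_of_mem_recDomain hq hz.1 hz.2)
      (fun z hz => (hyd z hz.1).continuousAt.continuousWithinAt) fun z hz => hy z hz.1 hz.2
  by_cases hj : j = 1
  · subst hj
    have hs := closedBall_subset_recDomain hq
    -- At the branch point no estimate is available, but the limit is defined there as the limit of
    -- the approximants, so the Cauchy property suffices.
    exact h.of_diff_singleton (half_pos hq) hs
      (fun n z hz => (colApprox_differentiableAt hu (ne_zero_of_mem_recDomain (hs hz))
        (hyd z (hs hz)) _).differentiableWithinAt) fun hc => hc.tendsto_limUnder
  · rwa [Set.sdiff_singleton_eq_self] at h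
    intro hp
    have h0 : 0 ≤ (-(I * (q0 : ℂ))).im := by
      fin_cases j
      · exact hp.1
      · exact absurd rfl hj
      · exact hp.1
    simp at h0
    linarith

theorem colLimit_continuousOn (hv : ‖v‖ = q0) (hq : 0 < q0)
    (hB : ∀ a : ℝ, IntegrableOn (fun x => u x - v) (Set.Iio a))
    (hyd : ∀ z ∈ recDomain q0 j, DifferentiableAt ℂ y z)
    (hy : ∀ z ∈ recDomain q0 j, z ≠ -(I * q0) → laxA q0 z v * y z = expo q0 z j • y z) :
    ContinuousOn (colLimit q0 u j y) (recDomain q0 j) :=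
  (colLimit_tendstoLocallyUniformlyOn_recDomain hv hq hB hyd hy).continuousOn
    (Frequently.of_forall fun _ z hz => (colApprox_differentiableAt (locallyIntegrable_of_Iio hB)
      (ne_zero_of_mem_recDomain hz) (hyd z hz) _).continuousAt.continuousWithinAt)

theorem colLimit_differentiableOn (hv : ‖v‖ = q0) (hq : 0 < q0)
    (hB : ∀ a : ℝ, IntegrableOn (fun x => u x - v) (Set.Iio a))
    (hyd : ∀ z ∈ recDomain q0 j, DifferentiableAt ℂ y z)
    (hy : ∀ z ∈ recDomain q0 j, z ≠ -(I * q0) → laxA q0 z v * y z = expo q0 z j • y z)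
    {U : Set ℂ} (hU : IsOpen U) (hUD : U ⊆ recDomain q0 j) :
    DifferentiableOn ℂ (colLimit q0 u j y) U :=
  ((colLimit_tendstoLocallyUniformlyOn_recDomain hv hq hB hyd hy).mono hUD).differentiableOn
    (Eventually.of_forall fun _ z hz => (colApprox_differentiableAt (locallyIntegrable_of_Iio hB)
      (ne_zero_of_mem_recDomain (hUD hz)) (hyd z (hUD hz)) _).differentiableWithinAt) hU

/-- The `j`-th row of `matYInv`, as a column. -/
def rowYInv (q0 : ℝ) (v : Vec2) (j : Fin 3) (z : ℂ) : Mat3 :=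
  (Matrix.single j j 1 * matYInv q0 v z).transpose

theorem laxA_negConj_mul_rowYInv (hv : ‖v‖ = q0) (hq : q0 ≠ 0) (hz : z ≠ 0)
    (hw : z ^ 2 + (q0 : ℂ) ^ 2 ≠ 0) :
    laxA q0 z (negConj v) * rowYInv q0 v j z = expo q0 z j • rowYInv q0 v j z := by
  rw [rowYInv, laxA_negConj, ← Matrix.transpose_mul, mul_assoc, matYInv_mul_laxA hv hq hz hw,
    ← mul_assoc, single_mul_diagonal_self, Matrix.smul_mul, Matrix.transpose_smul]

theorem sq_add_sq_ne_zero_of_mem_recDomain (hq : 0 < q0) (h : z ∈ recDomain q0 j) (hj : j ≠ 1) :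
    z ^ 2 + (q0 : ℂ) ^ 2 ≠ 0 := by
  refine (isRecessive_of_mem_recDomain hq h ?_).sq_ne
  rintro rfl
  have h0 : 0 ≤ (-(I * (q0 : ℂ))).im := by
    fin_cases j
    · exact h.1
    · exact absurd rfl hj
    · exact h.1
  simp at h0
  linarith

theorem differentiableAt_colY (q0 : ℝ) (v : Vec2) (j : Fin 3) (hz : z ≠ 0) :
    DifferentiableAt ℂ (colY q0 v j) z :=
  (differentiableAt_matY q0 v hz).mul_const _

theorem differentiableAt_rowYInv (v : Vec2) (hq : 0 < q0) (hz : z ∈ recDomain q0 j) :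
    DifferentiableAt ℂ (rowYInv q0 v j) z := by
  by_cases hj : j = 1
  · subst hj
    refine differentiableAt_mat fun i l => ?_
    -- The middle row of the inverse does not depend on `z`, so it has no pole at the branch point.
    have : ∀ w, rowYInv q0 v 1 w i l = rowYInv q0 v 1 0 i l := by
      intro w
      fin_cases i <;> fin_cases l <;>
        simp [rowYInv, matYInv, Matrix.mul_apply, Matrix.single]
    simp only [this]
    exact differentiableAt_const _
  · refine differentiableAt_mat fun i l => ?_
    have h := (differentiableAt_matYInv v hq.ne'
      (sq_add_sq_ne_zero_of_mem_recDomain hq hz hj)).const_mul (Matrix.single j j (1 : ℂ))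
    exact (entryL l i).differentiableAt.comp z h

theorem MeasureTheory.IntegrableOn.comp_neg_real {f : ℝ → Vec2} {s : Set ℝ}
    (h : IntegrableOn f s) : IntegrableOn (fun x => f (-x)) (Neg.neg ⁻¹' s) :=
  ((Measure.measurePreserving_neg (volume : Measure ℝ)).integrableOn_comp_preimage
    (Homeomorph.neg ℝ).measurableEmbedding).2 h

/-- The potential whose Lax solutions are the transposed inverses, reflected. -/
def adjointPot (u : ℝ → Vec2) (x : ℝ) : Vec2 := negConj (u (-x))

theorem integrableOn_adjointPot (hT : ∀ a : ℝ, IntegrableOn (fun x => u x - v) (Set.Ioi a))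
    (a : ℝ) : IntegrableOn (fun x => adjointPot u x - negConj v) (Set.Iio a) := by
  have h1 : IntegrableOn (fun x => u (-x) - v) (Set.Iio a) := by
    simpa using (hT (-a)).comp_neg_real
  let L : Vec2 →L[ℝ] Vec2 := LinearMap.toContinuousLinearMap
    { toFun := negConj
      map_add' := fun a b => by ext i; fin_cases i <;> simp [negConj] <;> ring
      map_smul' := fun a b => by ext i; fin_cases i <;> simp [negConj] }
  have h2 := L.integrable_comp h1
  simp only [map_sub] at h2
  exact h2

end Scattering

/-! ### Diagonal scattering coefficients and the reflection symmetry. -/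

section Entries

variable {q0 : ℝ} {u : ℝ → Vec2} {z : ℂ} {v vm vp : Vec2} {j : Fin 3} {σ t : ℝ}
  {ψ ψm ψp : ℝ → Mat3}

theorem isUnit_diagonal_exp (d : Fin 3 → ℂ) :
    IsUnit (Matrix.diagonal (fun j => exp (-(d j))) : Mat3) := by
  refine (Matrix.isUnit_diagonal).2 ?_
  rw [Pi.isUnit_iff]
  exact fun i => (exp_ne_zero _).isUnit

theorem isUnit_matY (hv : ‖v‖ = q0) (hq : q0 ≠ 0) (hz : z ∈ contSpec q0) :
    IsUnit (matY q0 v z) := by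
  obtain ⟨h0, h1, h2⟩ := contSpec_ne hz
  exact IsUnit.of_mul_eq_one _ (matY_mul_matYInv hv hq h0 (sq_add_sq_ne_zero h1 h2))

/-- The entrywise topology of the definition is that of the operator norm, in which the estimates
are made. -/
theorem IsJost.tendsto {l : Filter ℝ} (h : IsJost σ q0 u t l v z ψ) :
    Tendsto (fun x => ψ x * Matrix.diagonal fun j => exp (-(I * phase σ q0 x t z j))) l
      (𝓝 (matY q0 v z)) := h.2

/-- The limit `Y` is invertible and units form an open set, so the solution is invertible at some
`x`; the flow carries this to `0`. -/
theorem IsJost.isUnit_apply_zero {l : Filter ℝ} [l.NeBot] (hu : LocallyIntegrable u) (hv : ‖v‖ = q0)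
    (hq : q0 ≠ 0) (hz : z ∈ contSpec q0) (h : IsJost σ q0 u t l v z ψ) : IsUnit (ψ 0) := by
  have h1 := h.tendsto.eventually ((Units.isOpen (R := Mat3)).mem_nhds (isUnit_matY hv hq hz))
  obtain ⟨x, hx⟩ := h1.exists
  have hx' : IsUnit (ψ x * Matrix.diagonal fun j => exp (-(I * phase σ q0 x t z j))) := hx
  obtain ⟨D, hD⟩ := isUnit_diagonal_exp fun j => I * phase σ q0 x t z j
  rw [← hD, Units.isUnit_mul_units, ((solvesLaxX_iff hu).1 h.1).eq_laxFund_mul hu x] at hx'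
  have e : ψ 0 = laxFundInv q0 u z x * (laxFund q0 u z x * ψ 0) := by
    rw [← mul_assoc, laxFundInv_mul_laxFund hu, one_mul]
  rw [e]
  exact (IsUnit.of_mul_eq_one _ (laxFundInv_mul_laxFund hu z x)).mul hx'

theorem IsJost.exists_isScatteringMatrix {l l' : Filter ℝ} [l.NeBot] [l'.NeBot]
    (hu : LocallyIntegrable u) (hvm : ‖vm‖ = q0) (hvp : ‖vp‖ = q0) (hq : q0 ≠ 0)
    (hz : z ∈ contSpec q0) (hm : IsJost σ q0 u t l vm z ψm) (hp : IsJost σ q0 u t l' vp z ψp) :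
    ∃ S, IsScatteringMatrix ψm ψp S := by
  obtain ⟨a, ha⟩ := hm.isUnit_apply_zero hu hvm hq hz
  obtain ⟨b, hb⟩ := hp.isUnit_apply_zero hu hvp hq hz
  refine ⟨((b⁻¹ * a : Mat3ˣ) : Mat3), Units.isUnit _, fun x => ?_⟩
  rw [((solvesLaxX_iff hu).1 hm.1).eq_laxFund_mul hu x,
    ((solvesLaxX_iff hu).1 hp.1).eq_laxFund_mul hu x, ← ha, ← hb, mul_assoc, Units.val_mul,
    Units.mul_inv_cancel_left]

/-- Transposing `Ψ' = -Ψ A` gives the coefficient `-Aᵀ`; the reflection removes the sign, and `Aᵀ`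
is the Lax matrix of the conjugate potential. -/
theorem laxFundInv_isLaxSol_adjoint (hu : LocallyIntegrable u) (z : ℂ) (c : Mat3) :
    IsLaxSol q0 (adjointPot u) z fun x => (c * laxFundInv q0 u z (-x)).transpose := by
  have h1 := ((laxFundInv_isPrimitive (q0 := q0) hu z).comp_neg.clm transposeL)
  have h2 : IsLaxSol q0 (adjointPot u) z fun x => (laxFundInv q0 u z (-x)).transpose := by
    unfold IsLaxSol
    convert! h1 using 2
    simp [adjointPot, laxA_negConj, Matrix.transpose_mul]
  simpa only [Matrix.transpose_mul] using h2.mul_const c.transpose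

theorem IsJost.colLimit_left (hvm : ‖vm‖ = q0) (hq : 0 < q0)
    (hB : ∀ a : ℝ, IntegrableOn (fun x => u x - vm) (Set.Iio a)) (hr : IsRecessive q0 j z)
    (hm : IsJost σ q0 u t atBot vm z ψm) :
    colLimit q0 u j (colY q0 vm j) z =
      exp (-(I * phase σ q0 0 t z j)) • (ψm 0 * Matrix.single j j 1) := by
  have hu := locallyIntegrable_of_Iio hB
  have hs := ((solvesLaxX_iff hu).1 hm.1).mul_const
    (exp (-(I * phase σ q0 0 t z j)) • Matrix.single j j 1)
  rw [← hs.apply_zero_eq_colLimit hvm hq.ne' hB hr (laxA_mul_colY hvm hq.ne' hr.ne_zero),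
    Matrix.mul_smul]
  refine (hm.tendsto.mul_const (Matrix.single j j 1)).congr fun x => ?_
  rw [mul_assoc, diagonal_mul_single_self, phase_eq σ q0 x, Matrix.mul_smul, Matrix.mul_smul,
    smul_smul, ← Complex.exp_add]
  congr 2
  ring

/-- Inverting the normalization at `+∞` gives the rows of `ψ₊⁻¹` the rows of `Y⁻¹` as asymptotics.
After transposition and reflection this is a recessive normalization at `-∞`, and uniqueness
applies. -/
theorem IsJost.colLimit_right (hvp : ‖vp‖ = q0) (hq : 0 < q0) (hu : LocallyIntegrable u)
    (hT : ∀ a : ℝ, IntegrableOn (fun x => u x - vp) (Set.Ioi a)) (hz : z ∈ contSpec q0)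
    (hr : IsRecessive q0 j z) (hp : IsJost σ q0 u t atTop vp z ψp) :
    colLimit q0 (adjointPot u) j (rowYInv q0 vp j) z =
      exp (I * phase σ q0 0 t z j) • (Matrix.single j j 1 * (ψp 0)⁻¹).transpose := by
  have hv' : ‖negConj vp‖ = q0 := (norm_negConj vp).trans hvp
  have hc := hp.isUnit_apply_zero hu hvp hq.ne' hz
  have hdet := (Matrix.isUnit_iff_isUnit_det _).1 hc
  have hs := laxFundInv_isLaxSol_adjoint (q0 := q0) hu z
    (exp (I * phase σ q0 0 t z j) • (Matrix.single j j 1 * (ψp 0)⁻¹))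
  have e0 := hs.apply_zero_eq_colLimit hv' hq.ne' (integrableOn_adjointPot hT) hr
    (laxA_negConj_mul_rowYInv hvp hq.ne' hr.ne_zero hr.sq_ne) ?_
  · rw [← e0, neg_zero, laxFundInv_zero hu, mul_one, Matrix.transpose_smul]
  · have hY : (matY q0 vp z)⁻¹ = matYInv q0 vp z :=
      Matrix.inv_eq_left_inv (matYInv_mul_matY hvp hq.ne' hr.ne_zero hr.sq_ne)
    have hinv : Tendsto (fun A : Mat3 => A⁻¹) (𝓝 (matY q0 vp z)) (𝓝 (matYInv q0 vp z)) := by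
      obtain ⟨U, hU⟩ := isUnit_matY hvp hq.ne' hz
      have := NormedRing.inverse_continuousAt U
      rw [ContinuousAt, hU, ← Matrix.nonsing_inv_eq_ringInverse, hY] at this
      simpa only [Matrix.nonsing_inv_eq_ringInverse] using this
    have h1 := (hinv.comp (hp.tendsto.comp tendsto_neg_atBot_atTop)).const_mul
      (Matrix.single j j (1 : ℂ))
    have h2 := (transposeL.continuous.tendsto _).comp h1
    refine h2.congr fun x => ?_
    have e1 : (ψp (-x) * Matrix.diagonal fun j => exp (-(I * phase σ q0 (-x) t z j)))⁻¹ =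
        Matrix.diagonal (fun j => exp (I * phase σ q0 (-x) t z j)) *
          ((ψp 0)⁻¹ * laxFundInv q0 u z (-x)) := by
      refine Matrix.inv_eq_left_inv ?_
      rw [((solvesLaxX_iff hu).1 hp.1).eq_laxFund_mul hu (-x)]
      calc _ = Matrix.diagonal (fun j => exp (I * phase σ q0 (-x) t z j)) *
            ((ψp 0)⁻¹ * (laxFundInv q0 u z (-x) * laxFund q0 u z (-x)) * ψp 0) *
            Matrix.diagonal fun j => exp (-(I * phase σ q0 (-x) t z j)) := by
            simp only [mul_assoc]
        _ = 1 := by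
            rw [laxFundInv_mul_laxFund hu, mul_one, Matrix.nonsing_inv_mul _ hdet, mul_one,
              Matrix.diagonal_mul_diagonal]
            simp [← Complex.exp_add]
    simp only [Function.comp, transposeL_apply]
    rw [e1, ← mul_assoc (Matrix.single j j (1 : ℂ)), single_mul_diagonal_self, phase_eq σ q0 (-x),
      Matrix.smul_mul, Matrix.smul_mul, Matrix.transpose_smul, Matrix.transpose_smul, smul_smul,
      ← Complex.exp_add, ← mul_assoc]
    congr 2
    push_cast
    ring

/-- The extension of the `j`-th diagonal scattering coefficient. -/
def diagExt (q0 : ℝ) (u : ℝ → Vec2) (vm vp : Vec2) (j : Fin 3) (z : ℂ) : ℂ :=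
  ((colLimit q0 (adjointPot u) j (rowYInv q0 vp j) z).transpose *
    colLimit q0 u j (colY q0 vm j) z) j j

/-- The time factors of row and column are reciprocal and cancel, leaving the `j`-th diagonal entry
of `ψ₊⁻¹ ψ₊ S`. -/
theorem IsScatteringMatrix.diagExt_eq {S : Mat3} (hvm : ‖vm‖ = q0) (hvp : ‖vp‖ = q0) (hq : 0 < q0)
    (hB : ∀ a : ℝ, IntegrableOn (fun x => u x - vm) (Set.Iio a))
    (hT : ∀ a : ℝ, IntegrableOn (fun x => u x - vp) (Set.Ioi a)) (hz : z ∈ contSpec q0)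
    (hr : IsRecessive q0 j z) (hm : IsJost σ q0 u t atBot vm z ψm)
    (hp : IsJost σ q0 u t atTop vp z ψp) (hS : IsScatteringMatrix ψm ψp S) :
    diagExt q0 u vm vp j z = S j j := by
  have hu := locallyIntegrable_of_Iio hB
  have hdet := (Matrix.isUnit_iff_isUnit_det _).1 (hp.isUnit_apply_zero hu hvp hq.ne' hz)
  rw [diagExt, hm.colLimit_left hvm hq hB hr, hp.colLimit_right hvp hq hu hT hz hr,
    Matrix.transpose_smul, Matrix.transpose_transpose, Matrix.smul_mul, Matrix.mul_smul, smul_smul,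
    ← Complex.exp_add, add_neg_cancel, Complex.exp_zero, one_smul, hS.2 0]
  have e : Matrix.single j j (1 : ℂ) * (ψp 0)⁻¹ * (ψp 0 * S * Matrix.single j j 1) =
      Matrix.single j j 1 * ((ψp 0)⁻¹ * ψp 0) * S * Matrix.single j j 1 := by
    simp only [mul_assoc]
  rw [e, Matrix.nonsing_inv_mul _ hdet, mul_one]
  simp

/-- Regions on which the `j`-th diagonal scattering coefficient extends. -/
structure IsExtRegion (q0 : ℝ) (j : Fin 3) (U : Set ℂ) : Prop where
  isOpen : IsOpen U
  subset : U ⊆ recDomain q0 j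
  closure_subset : closure U \ singularPts q0 ⊆ recDomain q0 j

theorem IsExtRegion.extendsAnalytically {U : Set ℂ} (hU : IsExtRegion q0 j U) (hvm : ‖vm‖ = q0)
    (hvp : ‖vp‖ = q0) (hq : 0 < q0)
    (hB : ∀ a : ℝ, IntegrableOn (fun x => u x - vm) (Set.Iio a))
    (hT : ∀ a : ℝ, IntegrableOn (fun x => u x - vp) (Set.Ioi a)) {ψm ψp : ℂ → ℝ → Mat3}
    (hψ : ∀ z ∈ contSpec q0, IsJost σ q0 u t atBot vm z (ψm z) ∧ IsJost σ q0 u t atTop vp z (ψp z))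
    {S : ℂ → Mat3} (hS : ∀ z ∈ contSpec q0, IsScatteringMatrix (ψm z) (ψp z) (S z)) :
    ExtendsAnalytically q0 U fun z => S z j j := by
  have hv' : ‖negConj vp‖ = q0 := (norm_negConj vp).trans hvp
  have d1 : ∀ z ∈ recDomain q0 j, DifferentiableAt ℂ (colY q0 vm j) z := fun z hz =>
    differentiableAt_colY q0 vm j (ne_zero_of_mem_recDomain hz)
  have d2 : ∀ z ∈ recDomain q0 j, DifferentiableAt ℂ (rowYInv q0 vp j) z := fun z hz =>
    differentiableAt_rowYInv vp hq hz
  have y1 : ∀ z ∈ recDomain q0 j, z ≠ -(I * q0) →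
      laxA q0 z vm * colY q0 vm j z = expo q0 z j • colY q0 vm j z := fun z hz _ =>
    laxA_mul_colY hvm hq.ne' (ne_zero_of_mem_recDomain hz)
  have y2 : ∀ z ∈ recDomain q0 j, z ≠ -(I * q0) →
      laxA q0 z (negConj vp) * rowYInv q0 vp j z = expo q0 z j • rowYInv q0 vp j z :=
    fun z hz hz' => laxA_negConj_mul_rowYInv hvp hq.ne' (ne_zero_of_mem_recDomain hz)
      (isRecessive_of_mem_recDomain hq hz hz').sq_ne
  let T : Mat3 →L[ℂ] Mat3 :=
    LinearMap.toContinuousLinearMap (Matrix.transposeLinearEquiv (Fin 3) (Fin 3) ℂ ℂ).toLinearMap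
  have hT' := integrableOn_adjointPot hT
  refine ⟨diagExt q0 u vm vp j, ?_, ?_, ?_⟩
  · refine DifferentiableOn.analyticOnNhd ?_ hU.isOpen
    have h1 := colLimit_differentiableOn hvm hq hB d1 y1 hU.isOpen hU.subset
    have h2 := colLimit_differentiableOn hv' hq hT' d2 y2 hU.isOpen hU.subset
    exact (entryL j j).differentiable.comp_differentiableOn
      ((T.differentiable.comp_differentiableOn h2).mul h1)
  · refine ContinuousOn.mono ?_ hU.closure_subset
    have h1 := colLimit_continuousOn hvm hq hB d1 y1
    have h2 := colLimit_continuousOn hv' hq hT' d2 y2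
    exact (entryL j j).continuous.comp_continuousOn
      ((T.continuous.comp_continuousOn h2).mul h1)
  · rintro z ⟨hzU, hz⟩
    exact (hS z hz).diagExt_eq hvm hvp hq hB hT hz
      (isRecessive_of_mem_recDomain hq (hU.closure_subset ⟨hzU, hz.2⟩) (contSpec_ne hz).2.2)
      (hψ z hz).1 (hψ z hz).2

theorem not_mem_singularPts {w : ℂ} (h0 : w ≠ 0) (h : ‖w‖ ≠ |q0|) : w ∉ singularPts q0 := by
  rintro (rfl | rfl | rfl)
  · exact h0 rfl
  · simp at h
  · simp at h

theorem isExtRegion_regU1 (hq : 0 < q0) : IsExtRegion q0 0 (regU1 q0) := by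
  have hc : closure (regU1 q0) \ singularPts q0 ⊆ recDomain q0 0 := by
    rintro z ⟨hz, hs⟩
    have h : z ∈ {z : ℂ | 0 ≤ z.im ∧ q0 ≤ ‖z‖} := closure_minimal
      (fun w (hw : w ∈ regU1 q0) => show 0 ≤ w.im ∧ q0 ≤ ‖w‖ from ⟨hw.1.le, hw.2.le⟩)
      ((isClosed_le continuous_const continuous_im).inter
        (isClosed_le continuous_const continuous_norm)) hz
    exact ⟨h.1, h.2, fun h => hs (Or.inl h), fun h => hs (Or.inr (Or.inl h))⟩
  refine ⟨(isOpen_lt continuous_const continuous_im).inter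
    (isOpen_lt continuous_const continuous_norm), fun z hz => hc ⟨subset_closure hz, ?_⟩, hc⟩
  refine not_mem_singularPts ?_ ?_
  · rintro rfl
    simpa using hz.1
  · rw [abs_of_pos hq]
    exact hz.2.ne'

theorem isExtRegion_lower : IsExtRegion q0 1 {z | z.im < 0} := by
  refine ⟨isOpen_lt continuous_im continuous_const, fun z hz => ⟨hz.le, ?_⟩, ?_⟩
  · rintro rfl
    simp at hz
  · rintro z ⟨hz, hs⟩
    have h : z ∈ {z : ℂ | z.im ≤ 0} := closure_minimal (fun z hz => le_of_lt hz)
      (isClosed_le continuous_im continuous_const) hz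
    exact ⟨h, fun h => hs (Or.inl h)⟩

theorem isExtRegion_regU4 (hq : 0 < q0) : IsExtRegion q0 2 (regU4 q0) := by
  have hc : closure (regU4 q0) \ singularPts q0 ⊆ recDomain q0 2 := by
    rintro z ⟨hz, hs⟩
    have h : z ∈ {z : ℂ | 0 ≤ z.im ∧ ‖z‖ ≤ q0} := closure_minimal
      (fun w (hw : w ∈ regU4 q0) => show 0 ≤ w.im ∧ ‖w‖ ≤ q0 from ⟨hw.1.le, hw.2.le⟩)
      ((isClosed_le continuous_const continuous_im).inter
        (isClosed_le continuous_norm continuous_const)) hz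
    exact ⟨h.1, h.2, fun h => hs (Or.inl h), fun h => hs (Or.inr (Or.inl h))⟩
  refine ⟨(isOpen_lt continuous_const continuous_im).inter
    (isOpen_lt continuous_norm continuous_const), fun z hz => hc ⟨subset_closure hz, ?_⟩, hc⟩
  refine not_mem_singularPts ?_ ?_
  · rintro rfl
    simpa using hz.1
  · rw [abs_of_pos hq]
    exact hz.2.ne

theorem neg_mem_contSpec (hz : z ∈ contSpec q0) : -z ∈ contSpec q0 := by
  obtain ⟨h0, h1, h2⟩ := contSpec_ne hz
  refine ⟨by simpa using hz.1, ?_⟩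
  rintro (h | h | h)
  · exact h0 (neg_eq_zero.1 h)
  · exact h2 (neg_eq_iff_eq_neg.1 h)
  · exact h1 (neg_inj.1 h)

theorem neg_mem_singularPts (hz : z ∈ singularPts q0) : -z ∈ singularPts q0 := by
  rcases hz with rfl | rfl | rfl
  · exact Or.inl neg_zero
  · exact Or.inr (Or.inr rfl)
  · exact Or.inr (Or.inl (neg_neg _))

theorem ExtendsAnalytically.comp_neg {U : Set ℂ} {s : ℂ → ℂ} (h : ExtendsAnalytically q0 U s) :
    ExtendsAnalytically q0 (Neg.neg ⁻¹' U) fun z => s (-z) := by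
  obtain ⟨F, h1, h2, h3⟩ := h
  have hc : closure (Neg.neg ⁻¹' U) = Neg.neg ⁻¹' closure U :=
    ((Homeomorph.neg ℂ).preimage_closure U).symm
  refine ⟨fun z => F (-z), fun z hz => (h1 (-z) hz).comp analyticAt_id.neg, ?_, ?_⟩
  · rw [hc]
    exact h2.comp continuous_neg.continuousOn fun z hz =>
      ⟨hz.1, fun h => hz.2 (neg_neg z ▸ neg_mem_singularPts h)⟩
  · rw [hc]
    exact fun z hz => h3 ⟨hz.1, neg_mem_contSpec hz.2⟩

theorem matJ_mul_matJ : matJ * matJ = 1 := by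
  rw [matJ, Matrix.diagonal_mul_diagonal, ← Matrix.diagonal_one]
  congr 1
  ext i
  fin_cases i <;> simp

theorem matJ_conj_apply (A : Mat3) (j : Fin 3) : (matJ * A * matJ) j j = A j j := by
  rw [matJ, Matrix.mul_diagonal, Matrix.diagonal_mul]
  fin_cases j <;> simp

/-- Reflection makes `ψ₊` the left solution, so the scattering matrix is inverted; the factors `J`
come from `Y(-z) = Y(z) J` for the opposite potential and do not affect diagonal entries. -/
theorem IsScatteringMatrix.reflect {S : Mat3} (h : IsScatteringMatrix ψm ψp S) :
    IsScatteringMatrix (fun x => ψp (-x) * matJ) (fun x => ψm (-x) * matJ)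
      (matJ * S⁻¹ * matJ) := by
  have hJ : IsUnit matJ := IsUnit.of_mul_eq_one _ matJ_mul_matJ
  refine ⟨(hJ.mul ((Matrix.isUnit_nonsing_inv_iff).2 h.1)).mul hJ, fun x => ?_⟩
  calc ψp (-x) * matJ = ψp (-x) * (S * S⁻¹) * matJ := by
        rw [Matrix.mul_nonsing_inv _ ((Matrix.isUnit_iff_isUnit_det _).1 h.1), mul_one]
    _ = ψp (-x) * S * (matJ * matJ) * S⁻¹ * matJ := by
        rw [matJ_mul_matJ]
        simp only [mul_assoc, one_mul]
    _ = ψm (-x) * matJ * (matJ * S⁻¹ * matJ) := by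
        rw [h.2 (-x)]
        simp only [mul_assoc]

theorem integrableOn_reflect_Iio (hT : ∀ a : ℝ, IntegrableOn (fun x => u x - v) (Set.Ioi a))
    (a : ℝ) : IntegrableOn (fun x => -u (-x) - -v) (Set.Iio a) := by
  have e : (fun x => -u (-x) - -v) = fun x => -(u (-x) - v) := by
    funext x
    abel
  have h : IntegrableOn (fun x => u (-x) - v) (Set.Iio a) := by
    simpa using (hT (-a)).comp_neg_real
  rw [e]
  exact h.neg

theorem integrableOn_reflect_Ioi (hB : ∀ a : ℝ, IntegrableOn (fun x => u x - v) (Set.Iio a))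
    (a : ℝ) : IntegrableOn (fun x => -u (-x) - -v) (Set.Ioi a) := by
  have e : (fun x => -u (-x) - -v) = fun x => -(u (-x) - v) := by
    funext x
    abel
  have h : IntegrableOn (fun x => u (-x) - v) (Set.Ioi a) := by
    simpa using (hB (-a)).comp_neg_real
  rw [e]
  exact h.neg

theorem exists_isJost_atTop (σ t : ℝ) (hv : ‖v‖ = q0) (hq : 0 < q0)
    (hT : ∀ a : ℝ, IntegrableOn (fun x => u x - v) (Set.Ioi a)) (hz : z ∈ contSpec q0) :
    ∃ ψ, IsJost σ q0 u t atTop v z ψ := by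
  have hB := integrableOn_reflect_Iio hT
  obtain ⟨ψ, hψ⟩ := exists_isJost_atBot σ t ((norm_neg v).trans hv) hq hB (neg_mem_contSpec hz)
  have h := hψ.reflect (locallyIntegrable_of_Iio hB) tendsto_neg_atTop_atBot
  simp only [neg_neg] at h
  exact ⟨_, h⟩

theorem IsExtRegion.extendsAnalytically_inv {U : Set ℂ} (hU : IsExtRegion q0 j U)
    (hvm : ‖vm‖ = q0) (hvp : ‖vp‖ = q0) (hq : 0 < q0)
    (hB : ∀ a : ℝ, IntegrableOn (fun x => u x - vm) (Set.Iio a))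
    (hT : ∀ a : ℝ, IntegrableOn (fun x => u x - vp) (Set.Ioi a)) {ψm ψp : ℂ → ℝ → Mat3}
    (hψ : ∀ z ∈ contSpec q0, IsJost σ q0 u t atBot vm z (ψm z) ∧ IsJost σ q0 u t atTop vp z (ψp z))
    {S : ℂ → Mat3} (hS : ∀ z ∈ contSpec q0, IsScatteringMatrix (ψm z) (ψp z) (S z)) :
    ExtendsAnalytically q0 (Neg.neg ⁻¹' U) fun z => (S z)⁻¹ j j := by
  have hu := locallyIntegrable_of_Iio hB
  have h := hU.extendsAnalytically ((norm_neg vp).trans hvp) ((norm_neg vm).trans hvm) hq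
    (integrableOn_reflect_Iio hT) (integrableOn_reflect_Ioi hB)
    (ψm := fun z x => ψp (-z) (-x) * matJ) (ψp := fun z x => ψm (-z) (-x) * matJ)
    (σ := σ) (t := t) (S := fun z => matJ * (S (-z))⁻¹ * matJ) (fun z hz => ?_)
    fun z hz => (hS _ (neg_mem_contSpec hz)).reflect
  · simpa only [matJ_conj_apply, neg_neg] using h.comp_neg
  · obtain ⟨h1, h2⟩ := hψ _ (neg_mem_contSpec hz)
    have h1' := h1.reflect hu tendsto_neg_atTop_atBot
    have h2' := h2.reflect hu tendsto_neg_atBot_atTop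
    rw [neg_neg] at h1' h2'
    exact ⟨h2', h1'⟩

theorem norm_exp_I_mul_smul (δ : ℝ) (v : Vec2) : ‖exp (I * δ) • v‖ = ‖v‖ := by
  rw [norm_smul, mul_comm I, norm_exp_ofReal_mul_I, one_mul]

theorem exists_jost_pair (σ t : ℝ) (hvm : ‖vm‖ = q0) (hvp : ‖vp‖ = q0) (hq : 0 < q0)
    (hB : ∀ a : ℝ, IntegrableOn (fun x => u x - vm) (Set.Iio a))
    (hT : ∀ a : ℝ, IntegrableOn (fun x => u x - vp) (Set.Ioi a)) :
    ∃ ψm ψp : ℂ → ℝ → Mat3, ∀ z ∈ contSpec q0,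
      IsJost σ q0 u t atBot vm z (ψm z) ∧ IsJost σ q0 u t atTop vp z (ψp z) := by
  choose! ψm hm using fun z (hz : z ∈ contSpec q0) => exists_isJost_atBot σ t hvm hq hB hz
  choose! ψp hp using fun z (hz : z ∈ contSpec q0) => exists_isJost_atTop σ t hvp hq hT hz
  exact ⟨ψm, ψp, fun z hz => ⟨hm z hz, hp z hz⟩⟩

end Entries

end

theorem theorem2 (σ : ℝ) (q₀ : Vec2) (hq₀ : q₀ ≠ 0) (δm δp : ℝ) (qm qp : Vec2)
    (hqm : qm = exp (I * δm) • q₀) (hqp : qp = exp (I * δp) • q₀)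
    (q : ℝ → ℝ → Vec2) (t : ℝ)
    (hm : ∀ a : ℝ, IntegrableOn (fun x => q x t - qm) (Set.Iio a))
    (hp : ∀ a : ℝ, IntegrableOn (fun x => q x t - qp) (Set.Ioi a)) :
    -- Jost eigenfunctions exist on the continuous spectrum
    (∃ ψm ψp : ℂ → ℝ → Mat3, ∀ z ∈ contSpec ‖q₀‖,
      IsJost σ ‖q₀‖ (fun x => q x t) t atBot qm z (ψm z) ∧
      IsJost σ ‖q₀‖ (fun x => q x t) t atTop qp z (ψp z)) ∧
    ∀ ψm ψp : ℂ → ℝ → Mat3,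
      (∀ z ∈ contSpec ‖q₀‖,
        IsJost σ ‖q₀‖ (fun x => q x t) t atBot qm z (ψm z) ∧
        IsJost σ ‖q₀‖ (fun x => q x t) t atTop qp z (ψp z)) →
      -- they have a scattering matrix
      (∃ S : ℂ → Mat3, ∀ z ∈ contSpec ‖q₀‖, IsScatteringMatrix (ψm z) (ψp z) (S z)) ∧
      -- the diagonal entries of `S` and of `H = S⁻¹` extend analytically
      ∀ S : ℂ → Mat3,
        (∀ z ∈ contSpec ‖q₀‖, IsScatteringMatrix (ψm z) (ψp z) (S z)) →
        ExtendsAnalytically ‖q₀‖ (regU1 ‖q₀‖) (fun z => S z 0 0) ∧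
        ExtendsAnalytically ‖q₀‖ {z | z.im < 0} (fun z => S z 1 1) ∧
        ExtendsAnalytically ‖q₀‖ (regU4 ‖q₀‖) (fun z => S z 2 2) ∧
        ExtendsAnalytically ‖q₀‖ (regU2 ‖q₀‖) (fun z => (S z)⁻¹ 0 0) ∧
        ExtendsAnalytically ‖q₀‖ {z | 0 < z.im} (fun z => (S z)⁻¹ 1 1) ∧
        ExtendsAnalytically ‖q₀‖ (regU3 ‖q₀‖) (fun z => (S z)⁻¹ 2 2) := by

  have hq : 0 < ‖q₀‖ := norm_pos_iff.2 hq₀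
  have hvm : ‖qm‖ = ‖q₀‖ := by rw [hqm, norm_exp_I_mul_smul]
  have hvp : ‖qp‖ = ‖q₀‖ := by rw [hqp, norm_exp_I_mul_smul]
  refine ⟨exists_jost_pair σ t hvm hvp hq hm hp, fun ψm ψp hψ => ⟨?_, fun S hS => ?_⟩⟩
  · choose! S hS using fun z (hz : z ∈ contSpec ‖q₀‖) => IsJost.exists_isScatteringMatrix
      (locallyIntegrable_of_Iio hm) hvm hvp hq.ne' hz (hψ z hz).1 (hψ z hz).2
    exact ⟨S, hS⟩
  -- The map `z ↦ -z` carries the regions for `S` to those for `S⁻¹`.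
  · have e2 : Neg.neg ⁻¹' regU1 ‖q₀‖ = regU2 ‖q₀‖ := by ext z; simp [regU1, regU2]
    have e1 : Neg.neg ⁻¹' {z : ℂ | z.im < 0} = {z | 0 < z.im} := by ext z; simp
    have e3 : Neg.neg ⁻¹' regU4 ‖q₀‖ = regU3 ‖q₀‖ := by ext z; simp [regU4, regU3]
    refine ⟨(isExtRegion_regU1 hq).extendsAnalytically hvm hvp hq hm hp hψ hS,
      isExtRegion_lower.extendsAnalytically hvm hvp hq hm hp hψ hS,
      (isExtRegion_regU4 hq).extendsAnalytically hvm hvp hq hm hp hψ hS, ?_, ?_, ?_⟩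
    · exact e2 ▸ (isExtRegion_regU1 hq).extendsAnalytically_inv hvm hvp hq hm hp hψ hS
    · exact e1 ▸ isExtRegion_lower.extendsAnalytically_inv hvm hvp hq hm hp hψ hS
    · exact e3 ▸ (isExtRegion_regU4 hq).extendsAnalytically_inv hvm hvp hq hm hp hψ hS
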